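/- Let $(\Omega,\mathcal F)$ be a measurable space and $\mathscr H$ a linear space of $\mathcal F$-measurable real functions on $\Omega$ such that $\varphi(X_1,\ldots,X_n)\in\mathscr H$ whenever $X_1,\ldots,X_n\in\mathscr H$ and $\varphi:\mathbb R^n\to\mathbb R$ satisfies $|\varphi(x)-\varphi(y)|\le C(1+|x|^m+|y|^m)|x-y|$ for some $C>0$, $m\in\mathbb N$. Let $\hat{\mathbb E}:\mathscr H\to[-\infty,\infty]$ be a sub-linear expectation: it is monotone, $\hat{\mathbb E}[c]=c$ for constants $c$, $\hat{\mathbb E}[X+Y]\le\hat{\mathbb E}[X]+\hat{\mathbb E}[Y]$ whenever the right-hand side is not of the form $\infty-\infty$, and $\hat{\mathbb E}[\lambda X]=\lambda\hat{\mathbb E}[X]$ for $\lambda\ge0$. Let $\mathscr H_b$ be the set of bounded elements of $\mathscr H$. For $A\subset\Omega$ put $$\hat V(A)=\inf\{\hat{\mathbb E}[\xi]: I_A\le\xi\in\mathscr H\},\qquad \widehat{\mathbb V}^*(A)=\inf\Big\{\sum_{n=1}^\infty\hat V(A_n): A\subset\bigcup_{n=1}^\infty A_n,\ A_n\in\mathcal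 F\Big\},$$ and let $C_{\hat V}(X)=\int_0^\infty\hat V(X\ge t)\,dt+\int_{-\infty}^0[\hat V(X\ge t)-1]\,dt$ be the Choquet integral. Assume condition (CC): $\mathscr P$ is a family of probability measures on $\sigma(\mathscr H)$ such that $\hat{\mathbb E}[X]=\sup_{P\in\mathscr P}E_P[X]$ for all $X\in\mathscr H_b$, and for every sequence $\boldsymbol Y=(Y_1,Y_2,\ldots)$ in $\mathscr H_b$ the family of laws $\{P\circ\boldsymbol Y^{-1}:P\in\mathscr P\}$ is a compact set of probability measures on $\mathbb R^{\mathbb N}$ (product topology) in the topology of weak convergence. Let $\{X_n;n\ge1\}\subset\mathscr H$ be i.i.d. under $\hat{\mathbb E}$, that is, $\hat{\mathbb E}[\varphi(X_i)]=\hat{\mathbb E}[\varphi(X_1)]$ for all $i\ge 1$ and all bounded Lipschitz $\varphi$ on $\mathbb R$, and $\hat{\mathbb E}[\varphi(X_1,\ldots,X_{i+1})]=\hat{\mathbb E}\big[\hat{\mathbb E}[\varphi(x_1,\ldots,x_i,X_{i+1})]\big|_{x_1=X_1,\ldots,x_i=X_i}\big]$ for all $i\ge1$ and all bounded Lipschitz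 $\varphi$ on $\mathbb R^{i+1}$. Assume $C_{\hat V}(|X_1|)<\infty$, and let $S_n=\sum_{i=1}^nX_i$. Then the limits $\overline\mu=\lim_{c\to\infty}\hat{\mathbb E}[(-c)\vee X_1\wedge c]$ and $\underline\mu=-\lim_{c\to\infty}\hat{\mathbb E}[(-c)\vee(-X_1)\wedge c]$ exist in $\mathbb R$, and the following hold. (a) For any Borel functions $\varphi_i:\mathbb R^i\to[\underline\mu,\overline\mu]$, $i=1,2,\ldots$, there is a probability measure $Q$ on $(\Omega,\sigma(\mathscr H))$ such that $E_Q[X]\le\hat{\mathbb E}[X]$ for all $X\in\mathscr H_b$ and $$\widehat{\mathbb V}^*\Big(\lim_{n\to\infty}\frac{S_n-\sum_{i=1}^n\varphi_i(X_1,\ldots,X_i)}{n}=0\Big)=Q\Big(\lim_{n\to\infty}\frac{S_n-\sum_{i=1}^n\varphi_i(X_1,\ldots,X_i)}{n}=0\Big)=1.$$ (b) For any continuous functions $\varphi_i:\mathbb R^i\to[\underline\mu,\overline\mu]$, $i=1,2,\ldots$, there is a probability measure $P\in\mathscr P$ such that $$\widehat{\mathbb V}^*\Big(\lim_{n\to\infty}\frac{S_n-\sum_{i=1}^n\varphi_i(X_1,\ldots,X_i)}{n}=0\Big)=P\Big(\lim_{n\to\infty}\frac{S_n-\sum_{i=1}^n\varphi_i(X_1,\ldots,X_i)}{n}=0\Big)=1.$$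 -/

import Mathlib

open MeasureTheory Filter Topology
open scoped ENNReal

/-- The class `C_{l,Lip}` of locally Lipschitz functions on `ℝⁿ` whose local Lipschitz constant grows
at most polynomially. (The sup norm of `Fin n → ℝ` gives the same class as the Euclidean norm.) -/
def IsLocLip {n : ℕ} (φ : (Fin n → ℝ) → ℝ) : Prop :=
  ∃ C : ℝ, 0 < C ∧ ∃ m : ℕ, ∀ x y : Fin n → ℝ,
    |φ x - φ y| ≤ C * (1 + ‖x‖ ^ m + ‖y‖ ^ m) * ‖x - y‖

/-- The class `C_{b,Lip}` of bounded Lipschitz functions. -/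
def IsBddLip {α : Type*} [PseudoEMetricSpace α] (φ : α → ℝ) : Prop :=
  (∃ M : ℝ, ∀ x, |φ x| ≤ M) ∧ ∃ K : NNReal, LipschitzWith K φ

/-- A sub-linear expectation space `(Ω, ℋ, 𝔼)` over the measurable space `Ω`.
The expectation is a function `ℋ → [-∞, ∞]`; it is written as a total function on `Ω → ℝ`, but its
axioms, and all notions below, involve only its values on `ℋ`. -/
structure SublinearExpectationSpace (Ω : Type*) [MeasurableSpace Ω] where
  /-- the linear space of random variables -/
  H : Submodule ℝ (Ω → ℝ)
  measurable_of_mem : ∀ X ∈ H, Measurable X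
  comp_mem : ∀ (n : ℕ) (X : Fin n → Ω → ℝ), (∀ i, X i ∈ H) →
    ∀ φ : (Fin n → ℝ) → ℝ, IsLocLip φ → (fun ω => φ (fun i => X i ω)) ∈ H
  /-- the sub-linear expectation -/
  E : (Ω → ℝ) → EReal
  mono : ∀ X ∈ H, ∀ Y ∈ H, (∀ ω, Y ω ≤ X ω) → E Y ≤ E X
  const : ∀ c : ℝ, E (fun _ => c) = (c : EReal)
  subadd : ∀ X ∈ H, ∀ Y ∈ H, ¬ (E X = ⊤ ∧ E Y = ⊥) → ¬ (E X = ⊥ ∧ E Y = ⊤) →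
    E (X + Y) ≤ E X + E Y
  pos_homog : ∀ X ∈ H, ∀ c : ℝ, 0 ≤ c → E (c • X) = (c : EReal) * E X

namespace SublinearExpectationSpace

variable {Ω : Type*} [MeasurableSpace Ω]

/-- The bounded elements `ℋ_b` of `ℋ`. -/
def Hb (S : SublinearExpectationSpace Ω) : Set (Ω → ℝ) :=
  {X | X ∈ S.H ∧ ∃ M : ℝ, ∀ ω, |X ω| ≤ M}

/-- The σ-algebra `σ(ℋ)` generated by `ℋ`. -/
abbrev sigmaH (S : SublinearExpectationSpace Ω) : MeasurableSpace Ω :=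
  ⨆ X ∈ S.H, MeasurableSpace.comap X (borel ℝ)

/-- Identical distribution of two random vectors, possibly on different spaces. -/
def IdentDist {Ω' : Type*} [MeasurableSpace Ω'] (S : SublinearExpectationSpace Ω)
    (S' : SublinearExpectationSpace Ω') {n : ℕ} (X : Fin n → Ω → ℝ) (X' : Fin n → Ω' → ℝ) : Prop :=
  ∀ φ : (Fin n → ℝ) → ℝ, IsBddLip φ →
    S.E (fun ω => φ (fun i => X i ω)) = S'.E (fun ω => φ (fun i => X' i ω))

/-- `Y` is independent to `X`: `𝔼[φ(X, Y)] = 𝔼[ 𝔼[φ(x, Y)] |_{x = X} ]`.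
As `φ` is bounded, the inner expectation is finite, so that `toReal` is harmless. -/
def IndepTo (S : SublinearExpectationSpace Ω) {n m : ℕ} (Y : Fin n → Ω → ℝ) (X : Fin m → Ω → ℝ) :
    Prop :=
  ∀ φ : (Fin m → ℝ) × (Fin n → ℝ) → ℝ, IsBddLip φ →
    S.E (fun ω => φ (fun i => X i ω, fun j => Y j ω)) =
      S.E (fun ω => (S.E (fun ω' => φ (fun i => X i ω, fun j => Y j ω'))).toReal)

/-- An i.i.d. sequence of random variables `X 0, X 1, …` in `ℋ`: all have the distribution of the
first one, and each is independent to the vector of its predecessors. -/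
structure IsIID (S : SublinearExpectationSpace Ω) (X : ℕ → Ω → ℝ) : Prop where
  mem : ∀ i, X i ∈ S.H
  identDist : ∀ i, IdentDist S S (fun _ : Fin 1 => X i) (fun _ : Fin 1 => X 0)
  indep : ∀ i, S.IndepTo (fun _ : Fin 1 => X (i + 1)) (fun j : Fin (i + 1) => X j)

/-- The upper capacity `A ↦ inf {𝔼[ξ] : 1_A ≤ ξ ∈ ℋ}`. Here `ξ ≥ 0`, hence `𝔼[ξ] ∈ [0, ∞]`. -/
noncomputable def upperCapacity (S : SublinearExpectationSpace Ω) (A : Set Ω) : ℝ≥0∞ :=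
  ⨅ (ξ : Ω → ℝ) (_ : ξ ∈ S.H) (_ : ∀ ω, A.indicator (fun _ => (1 : ℝ)) ω ≤ ξ ω), (S.E ξ).toENNReal

/-- The countably sub-additive extension of the upper capacity,
`A ↦ inf {∑ V(Aₙ) : A ⊆ ⋃ Aₙ}`, the `Aₙ` being events. -/
noncomputable def outerCapacity (S : SublinearExpectationSpace Ω) (A : Set Ω) : ℝ≥0∞ :=
  ⨅ (B : ℕ → Set Ω) (_ : ∀ n, MeasurableSet (B n)) (_ : A ⊆ ⋃ n, B n), ∑' n, S.upperCapacity (B n)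

/-- The Choquet integral `∫_0^∞ V(X ≥ t) dt + ∫_{-∞}^0 (V(X ≥ t) - 1) dt` with respect to the upper
capacity, which has values in `[0, 1]`. -/
noncomputable def choquet (S : SublinearExpectationSpace Ω) (X : Ω → ℝ) : EReal :=
  ((∫⁻ t in Set.Ioi (0 : ℝ), S.upperCapacity {ω | t ≤ X ω} : ℝ≥0∞) : EReal) -
    ((∫⁻ t in Set.Iio (0 : ℝ), (1 - S.upperCapacity {ω | t ≤ X ω}) : ℝ≥0∞) : EReal)

/-- The upper mean `lim_{c → ∞} 𝔼[(-c) ∨ X ∧ c]` of `X` exists and is the real number `μ`. -/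
def HasUpperMean (S : SublinearExpectationSpace Ω) (X : Ω → ℝ) (μ : ℝ) : Prop :=
  Tendsto (fun c : ℝ => S.E (fun ω => max (-c) (min (X ω) c))) atTop (𝓝 (μ : EReal))

/-- The lower mean of `X`, minus the upper mean of `-X`, exists and is the real number `μ`. -/
def HasLowerMean (S : SublinearExpectationSpace Ω) (X : Ω → ℝ) (μ : ℝ) : Prop :=
  S.HasUpperMean (-X) (-μ)

/-- Condition (CC) with the family `Pfam` of probability measures on `σ(ℋ)`: it represents `𝔼` on `ℋ_b`,
and for every sequence in `ℋ_b` the set of its laws under the members of `Pfam` is weakly compact. -/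
structure CC (S : SublinearExpectationSpace Ω) (Pfam : Set (@Measure Ω S.sigmaH)) : Prop where
  isProbability : ∀ P ∈ Pfam, IsProbabilityMeasure P
  representation : ∀ X ∈ S.Hb, S.E X = ⨆ P ∈ Pfam, ((∫ ω, X ω ∂P : ℝ) : EReal)
  compact : ∀ Y : ℕ → Ω → ℝ, (∀ i, Y i ∈ S.Hb) →
    IsCompact {ν : ProbabilityMeasure (ℕ → ℝ) |
      ∃ P ∈ Pfam, (ν : Measure (ℕ → ℝ)) =
        @Measure.map Ω (ℕ → ℝ) S.sigmaH _ (fun ω i => Y i ω) P}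

/-- The event `(S_n - ∑_{i ≤ n} φ_i(X_1, …, X_i)) / n → 0`. The sequences start at index `0`, so
that `φ i` is a function of `i + 1` variables. -/
def convSet (X : ℕ → Ω → ℝ) (φ : (i : ℕ) → (Fin (i + 1) → ℝ) → ℝ) : Set Ω :=
  {ω | Tendsto (fun n : ℕ =>
    (∑ i ∈ Finset.range n, X i ω -
      ∑ i ∈ Finset.range n, φ i (fun j : Fin (i + 1) => X j ω)) / (n : ℝ)) atTop (𝓝 0)}

end SublinearExpectationSpace

/-!
By (CC) and uniform integrability, the upper and the lower mean of `X 0` are its means under two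
measures `P₁`, `P₂` of the family. On `ℝ^ℕ` take the law `Q` of a chain whose conditional laws given
the past are mixtures of the laws of `X 0` under `P₁` and `P₂`, with weights chosen measurably so
that the `n`-th term minus `φ n` has conditional mean zero. The strong law of large numbers for
martingale differences gives the convergence `Q`-almost surely, and by independence the
`Q`-expectations of bounded Lipschitz functions of finitely many terms are dominated by `𝔼`.

Such a domination transfers almost sure events: a Borel set `A` with `Q A = 1` has probability one
under some `P` of the family. Indeed, the function equal to `∞` off `A` and to `0` on `A` lies below
a lower semicontinuous `g` of finite `Q`-integral (Vitali–Carathéodory), `g` is an increasing limit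
of bounded Lipschitz functions of finitely many coordinates, and compactness yields one `P` for all
of these functions, so that `g` is `P`-almost surely finite.
-/

open ProbabilityTheory

section BoundedLipschitz

variable {α β γ : Type*} [PseudoEMetricSpace α] [PseudoEMetricSpace β] {f : β → ℝ}

lemma IsBddLip.neg (hf : IsBddLip f) : IsBddLip fun x => -f x := by
  obtain ⟨⟨M, hM⟩, K, hK⟩ := hf
  exact ⟨⟨M, fun x => (abs_neg (f x)).trans_le (hM x)⟩, K, hK.neg⟩

lemma IsBddLip.comp (hf : IsBddLip f) {g : α → β} {K : NNReal} (hg : LipschitzWith K g) :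
    IsBddLip fun x => f (g x) := by
  obtain ⟨⟨M, hM⟩, L, hL⟩ := hf
  exact ⟨⟨M, fun x => hM _⟩, L * K, hL.comp hg⟩

lemma IsBddLip.measurable [MeasurableSpace β] [OpensMeasurableSpace β] (hf : IsBddLip f) :
    Measurable f := by
  obtain ⟨-, K, hK⟩ := hf
  exact hK.continuous.measurable

lemma IsBddLip.integrable_comp [MeasurableSpace β] [OpensMeasurableSpace β] (hf : IsBddLip f)
    {m : MeasurableSpace γ} {P : Measure γ} [IsFiniteMeasure P] {u : γ → β} (hu : Measurable u) :
    Integrable (fun x => f (u x)) P := by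
  obtain ⟨M, hM⟩ := hf.1
  exact .of_bound (hf.measurable.comp hu).aestronglyMeasurable M (ae_of_all _ fun x => hM _)

end BoundedLipschitz

/-! ### Martingale differences -/

lemma tendsto_average_of_tendsto_sum_div {d : ℕ → ℝ} {c : ℝ}
    (h : Tendsto (fun n => ∑ i ∈ Finset.range n, d i / (i + 1)) atTop (𝓝 c)) :
    Tendsto (fun n : ℕ => (∑ i ∈ Finset.range n, d i) / n) atTop (𝓝 0) := by
  set s : ℕ → ℝ := fun n => ∑ i ∈ Finset.range n, d i / (i + 1)
  have summation_by_parts (n : ℕ) :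
      ∑ i ∈ Finset.range n, d i = n * s n - ∑ i ∈ Finset.range n, s i := by
    induction n with
    | zero => simp
    | succ n ih =>
      rw [Finset.sum_range_succ, ih, Finset.sum_range_succ _ n,
        show s (n + 1) = s n + d n / (n + 1) from Finset.sum_range_succ _ _]
      push_cast
      field_simp
      ring
  have hlim := h.sub h.cesaro
  rw [sub_self] at hlim
  refine hlim.congr' ?_
  filter_upwards [eventually_gt_atTop 0] with n hn
  rw [summation_by_parts]
  field_simp

section Martingale

variable {Ω : Type*} {m0 : MeasurableSpace Ω} {μ : Measure Ω} [IsFiniteMeasure μ]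
  {ℱ : Filtration ℕ m0}

lemma integral_mul_eq_zero_of_condExp_eq_zero {m : MeasurableSpace Ω} (hm : m ≤ m0)
    {f g : Ω → ℝ} (hf : StronglyMeasurable[m] f) (hf2 : MemLp f 2 μ) (hg2 : MemLp g 2 μ)
    (hg : μ[g | m] =ᵐ[μ] 0) : ∫ ω, f ω * g ω ∂μ = 0 := by
  have h : μ[f * g | m] =ᵐ[μ] 0 := by
    filter_upwards [condExp_mul_of_stronglyMeasurable_left hf (hf2.integrable_mul hg2)
      (hg2.integrable one_le_two), hg] with ω h1 h2
    simp [h1, h2]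
  calc ∫ ω, f ω * g ω ∂μ = ∫ ω, (μ[f * g | m]) ω ∂μ := (integral_condExp hm).symm
    _ = 0 := by rw [integral_congr_ae h]; simp

lemma eLpNorm_one_le_of_integral_sq_le {f : Ω → ℝ} (hf : MemLp f 2 μ) {R : ℝ}
    (h : ∫ ω, f ω ^ 2 ∂μ ≤ R) : eLpNorm f 1 μ ≤ (μ.real Set.univ + R).toNNReal := by
  have hi := hf.integrable one_le_two
  rw [eLpNorm_one_eq_lintegral_enorm, ← ofReal_integral_norm_eq_lintegral_enorm hi]
  refine ENNReal.ofReal_le_ofReal ?_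
  calc ∫ ω, ‖f ω‖ ∂μ ≤ ∫ ω, (1 + f ω ^ 2) ∂μ := by
        refine integral_mono hi.norm ((integrable_const 1).add hf.integrable_sq) fun ω => ?_
        rw [Real.norm_eq_abs, ← sq_abs]
        nlinarith [sq_nonneg (|f ω| - 1), abs_nonneg (f ω)]
    _ = μ.real Set.univ + ∫ ω, f ω ^ 2 ∂μ := by
        rw [integral_add (integrable_const 1) hf.integrable_sq]
        simp
    _ ≤ μ.real Set.univ + R := by gcongr

section MartingaleDifference

variable {d : ℕ → Ω → ℝ} (hd : ∀ i, StronglyMeasurable[ℱ (i + 1)] (d i))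
  (hd2 : ∀ i, MemLp (d i) 2 μ) (hd0 : ∀ i, μ[d i | ℱ i] =ᵐ[μ] 0)

include hd in
lemma stronglyAdapted_sum_range : StronglyAdapted ℱ fun n => ∑ i ∈ Finset.range n, d i :=
  fun _ => Finset.stronglyMeasurable_sum _ fun i hi =>
    (hd i).mono (ℱ.mono (Finset.mem_range.1 hi))

include hd hd2 hd0

lemma integral_sq_sum_range (n : ℕ) :
    ∫ ω, (∑ i ∈ Finset.range n, d i ω) ^ 2 ∂μ = ∑ i ∈ Finset.range n, ∫ ω, d i ω ^ 2 ∂μ := by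
  induction n with
  | zero => simp
  | succ n ih =>
    set f : Ω → ℝ := fun ω => ∑ i ∈ Finset.range n, d i ω with hf
    have hf' : f = ∑ i ∈ Finset.range n, d i := by ext; simp [hf]
    have hf2 : MemLp f 2 μ := memLp_finsetSum _ fun i _ => hd2 i
    have horth : ∫ ω, f ω * d n ω ∂μ = 0 :=
      integral_mul_eq_zero_of_condExp_eq_zero (ℱ.le n)
        (hf' ▸ stronglyAdapted_sum_range hd n) hf2 (hd2 n) (hd0 n)
    have hfd : Integrable (fun ω => f ω * d n ω) μ := hf2.integrable_mul (hd2 n)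
    simp only [Finset.sum_range_succ]
    rw [← ih]
    calc ∫ ω, (f ω + d n ω) ^ 2 ∂μ
        = ∫ ω, (f ω ^ 2 + 2 * (f ω * d n ω) + d n ω ^ 2) ∂μ := by congr with ω; ring
      _ = ∫ ω, f ω ^ 2 ∂μ + ∫ ω, d n ω ^ 2 ∂μ := by
        rw [integral_add (f := fun ω => f ω ^ 2 + 2 * (f ω * d n ω))
          (hf2.integrable_sq.add (hfd.const_mul 2)) (hd2 n).integrable_sq,
          integral_add hf2.integrable_sq (hfd.const_mul 2), integral_const_mul, horth, mul_zero,
          add_zero]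

lemma ae_exists_tendsto_sum_of_summable_integral_sq
    (hsum : Summable fun i => ∫ ω, d i ω ^ 2 ∂μ) :
    ∀ᵐ ω ∂μ, ∃ c, Tendsto (fun n => ∑ i ∈ Finset.range n, d i ω) atTop (𝓝 c) := by
  have hint (n : ℕ) : MemLp (∑ i ∈ Finset.range n, d i) 2 μ := memLp_finsetSum' _ fun i _ => hd2 i
  have hmart : Martingale (fun n => ∑ i ∈ Finset.range n, d i) ℱ μ := by
    refine martingale_of_condExp_sub_eq_zero_nat (stronglyAdapted_sum_range hd)
      (fun n => (hint n).integrable one_le_two) fun n => ?_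
    simpa [Finset.sum_range_succ] using hd0 n
  have hL1 (n : ℕ) : eLpNorm (∑ i ∈ Finset.range n, d i) 1 μ ≤
      (μ.real Set.univ + ∑' i, ∫ ω, d i ω ^ 2 ∂μ).toNNReal := by
    refine eLpNorm_one_le_of_integral_sq_le (hint n) ?_
    simp only [Finset.sum_apply, integral_sq_sum_range hd hd2 hd0]
    exact hsum.sum_le_tsum _ fun i _ => integral_nonneg fun ω => sq_nonneg _
  simpa only [Finset.sum_apply] using hmart.submartingale.exists_ae_tendsto_of_bdd hL1

end MartingaleDifference

lemma integral_sq_sub_condExp_le {m : MeasurableSpace Ω} (hm : m ≤ m0) {X : Ω → ℝ}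
    (hX : MemLp X 2 μ) : ∫ ω, (X ω - (μ[X | m]) ω) ^ 2 ∂μ ≤ ∫ ω, X ω ^ 2 ∂μ := by
  have h := setIntegral_condVar (hm := hm) (hX.sub (hX.condExp one_le_two)).integrable_sq .univ
  simp only [Measure.restrict_univ] at h
  calc ∫ ω, (X ω - (μ[X | m]) ω) ^ 2 ∂μ = ∫ ω, (Var[X; μ | m]) ω ∂μ := h.symm
    _ ≤ ∫ ω, (μ[X ^ 2 | m]) ω ∂μ :=
      integral_mono_ae integrable_condVar integrable_condExp (condVar_ae_le_condExp_sq hm hX)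
    _ = ∫ ω, X ω ^ 2 ∂μ := integral_condExp hm

theorem ae_tendsto_average_sub_condExp {ξ : ℕ → Ω → ℝ}
    (hξ : ∀ i, StronglyMeasurable[ℱ (i + 1)] (ξ i)) (hξ2 : ∀ i, MemLp (ξ i) 2 μ)
    (hsum : Summable fun i : ℕ => (∫ ω, ξ i ω ^ 2 ∂μ) / (i + 1 : ℝ) ^ 2) :
    ∀ᵐ ω ∂μ, Tendsto
      (fun n : ℕ => (∑ i ∈ Finset.range n, (ξ i ω - (μ[ξ i | ℱ i]) ω)) / n) atTop (𝓝 0) := by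
  set d : ℕ → Ω → ℝ := fun i => (i + 1 : ℝ)⁻¹ • (ξ i - μ[ξ i | ℱ i]) with hd
  have hdm (i : ℕ) : StronglyMeasurable[ℱ (i + 1)] (d i) :=
    ((hξ i).sub (stronglyMeasurable_condExp.mono (ℱ.mono i.le_succ))).const_smul _
  have hd2 (i : ℕ) : MemLp (d i) 2 μ := ((hξ2 i).sub ((hξ2 i).condExp one_le_two)).const_smul _
  have hd0 (i : ℕ) : μ[d i | ℱ i] =ᵐ[μ] 0 := by
    have hi := (hξ2 i).integrable one_le_two
    filter_upwards [condExp_smul (μ := μ) (i + 1 : ℝ)⁻¹ (ξ i - μ[ξ i | ℱ i]) (ℱ i),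
      condExp_sub (m := ℱ i) hi (integrable_condExp (m := ℱ i) (f := ξ i)),
      condExp_condExp_of_le (f := ξ i) (μ := μ) le_rfl (ℱ.le i)] with ω h1 h2 h3
    simp [hd, h1, h2, h3]
  have hdsum : Summable fun i => ∫ ω, d i ω ^ 2 ∂μ := by
    refine hsum.of_nonneg_of_le (fun i => integral_nonneg fun ω => sq_nonneg _) fun i => ?_
    simp only [hd, Pi.smul_apply, Pi.sub_apply, smul_eq_mul, mul_pow, integral_const_mul]
    rw [div_eq_inv_mul, inv_pow]
    exact mul_le_mul_of_nonneg_left (integral_sq_sub_condExp_le (ℱ.le i) (hξ2 i)) (by positivity)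
  filter_upwards [ae_exists_tendsto_sum_of_summable_integral_sq hdm hd2 hd0 hdsum]
    with ω ⟨c, hc⟩
  refine tendsto_average_of_tendsto_sum_div (c := c) (hc.congr fun n => ?_)
  simp [hd, div_eq_inv_mul]

end Martingale

/-! ### Chains with prescribed conditional laws -/

section Chain

variable {E : Type*}

/-- The first `n` terms of a sequence. -/
def initialSegment (n : ℕ) (z : ℕ → E) : Fin n → E := fun j => z j

variable [MeasurableSpace E]

@[fun_prop]
lemma measurable_initialSegment (n : ℕ) : Measurable (initialSegment n : (ℕ → E) → _) :=
  measurable_pi_lambda _ fun j => measurable_pi_apply (j : ℕ)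

lemma measurable_initialSegment_prodMk (n : ℕ) :
    Measurable fun z : ℕ → E => (initialSegment n z, z n) := by fun_prop

/-- `Q` is the law of a sequence of which, for every `n`, the term of index `n` has conditional
law `κ n` given the terms that precede it. -/
def IsChainLaw (Q : Measure (ℕ → E)) (κ : (n : ℕ) → Kernel (Fin n → E) E) : Prop :=
  ∀ n, HasCondDistrib (fun z => z n) (initialSegment n) (κ n) Q

/-- The filtration on sequences for which the first `n` terms are known at time `n`. -/
def initialFiltration (E : Type*) [MeasurableSpace E] :
    Filtration ℕ (inferInstance : MeasurableSpace (ℕ → E)) where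
  seq n := MeasurableSpace.comap (initialSegment n) inferInstance
  mono' n m hnm := by
    have restrict : initialSegment (E := E) n =
        (fun p j => p (Fin.castLE hnm j)) ∘ initialSegment m := rfl
    beta_reduce
    rw [restrict, ← MeasurableSpace.comap_comp]
    exact MeasurableSpace.comap_mono (Measurable.comap_le (by fun_prop))
  le' n := (measurable_initialSegment n).comap_le

lemma measurable_initialFiltration_prodMk (n : ℕ) :
    Measurable[initialFiltration E (n + 1)] fun z => (initialSegment n z, z n) := by
  have : (fun z : ℕ → E => (initialSegment n z, z n)) =
      (fun p => (fun j => p j.castSucc, p (Fin.last n))) ∘ initialSegment (n + 1) := rfl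
  rw [this]
  exact Measurable.comp (by fun_prop) (comap_measurable _)

theorem exists_isChainLaw [Nonempty E] (κ : (n : ℕ) → Kernel (Fin n → E) E)
    [∀ n, IsMarkovKernel (κ n)] :
    ∃ Q : Measure (ℕ → E), IsProbabilityMeasure Q ∧ IsChainLaw Q κ := by
  obtain ⟨x₀⟩ := ‹Nonempty E›
  -- `Kernel.trajMeasure` needs a law for its first term: start at `x₀`, then discard that term.
  let drop (n : ℕ) (w : Finset.Iic n → E) : Fin n → E := fun j => w ⟨j + 1, Finset.mem_Iic.2 j.2⟩
  have hdrop (n : ℕ) : Measurable (drop n) := by fun_prop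
  let shift : (ℕ → E) → ℕ → E := fun w n => w (n + 1)
  have hshift : Measurable shift := by fun_prop
  let R : Measure (ℕ → E) :=
    Kernel.trajMeasure (.dirac x₀) fun n => (κ n).comap (drop n) (hdrop n)
  refine ⟨R.map shift, Measure.isProbabilityMeasure_map hshift.aemeasurable, fun n => ?_⟩
  have h : HasCondDistrib (fun w => w (n + 1)) (Preorder.frestrictLe (π := fun _ => E) n)
      ((κ n).comap (drop n) (hdrop n)) R :=
    ⟨by fun_prop, (Kernel.map_frestrictLe_trajMeasure_compProd_eq_map_trajMeasure).symm⟩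
  refine ⟨(measurable_initialSegment_prodMk n).aemeasurable, ?_⟩
  rw [Measure.map_map (by fun_prop) hshift, Measure.map_map (by fun_prop) hshift]
  exact h.comp_right.map_eq

variable {κ : (n : ℕ) → Kernel (Fin n → E) E} [∀ n, IsMarkovKernel (κ n)]
  {Q : Measure (ℕ → E)} [IsProbabilityMeasure Q]

lemma IsChainLaw.map_le (hQ : IsChainLaw Q κ) {n : ℕ} {θ : Measure E}
    (hκ : ∀ p, κ n p ≤ θ) : Q.map (fun z => z n) ≤ θ := by
  refine Measure.le_iff.2 fun s hs => ?_
  have hsnd : Q.map (fun z => z n) = (Q.map fun z => (initialSegment n z, z n)).snd := by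
    rw [Measure.snd_map_prodMk (measurable_initialSegment n)]
  have := Measure.isProbabilityMeasure_map (μ := Q)
    (measurable_initialSegment (E := E) n).aemeasurable
  rw [hsnd, (hQ n).map_eq, Measure.snd_compProd, Measure.bind_apply hs (κ n).aemeasurable]
  calc ∫⁻ p, κ n p s ∂Q.map (initialSegment n) ≤ ∫⁻ _, θ s ∂Q.map (initialSegment n) :=
        lintegral_mono fun p => hκ p s
    _ = θ s := by simp

lemma IsChainLaw.integral_le_integral (hQ : IsChainLaw Q κ) {n : ℕ} {h : (Fin n → E) × E → ℝ}
    {ψ : (Fin n → E) → ℝ} (hm : Measurable h) (hψ : Measurable ψ)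
    (hi : Integrable (fun z => h (initialSegment n z, z n)) Q)
    (hψi : Integrable (fun z => ψ (initialSegment n z)) Q)
    (hle : ∀ p, ∫ x, h (p, x) ∂κ n p ≤ ψ p) :
    ∫ z, h (initialSegment n z, z n) ∂Q ≤ ∫ z, ψ (initialSegment n z) ∂Q := by
  have hinit := (measurable_initialSegment (E := E) n).aemeasurable (μ := Q)
  have hpair := (measurable_initialSegment_prodMk (E := E) n).aemeasurable (μ := Q)
  have := Measure.isProbabilityMeasure_map hinit
  have hcomp : Integrable h (Q.map (initialSegment n) ⊗ₘ κ n) := by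
    rwa [← (hQ n).map_eq, integrable_map_measure hm.aestronglyMeasurable hpair]
  calc ∫ z, h (initialSegment n z, z n) ∂Q
      = ∫ q, h q ∂(Q.map (initialSegment n) ⊗ₘ κ n) := by
        rw [← (hQ n).map_eq, integral_map hpair hm.aestronglyMeasurable]
    _ = ∫ p, ∫ x, h (p, x) ∂κ n p ∂Q.map (initialSegment n) := Measure.integral_compProd hcomp
    _ ≤ ∫ p, ψ p ∂Q.map (initialSegment n) := integral_mono hcomp.integral_compProd
        ((integrable_map_measure hψ.aestronglyMeasurable hinit).2 hψi) hle
    _ = ∫ z, ψ (initialSegment n z) ∂Q := integral_map hinit hψ.aestronglyMeasurable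

lemma IsChainLaw.condExp_ae_eq [StandardBorelSpace E] [Nonempty E] (hQ : IsChainLaw Q κ) {n : ℕ}
    {h : (Fin n → E) × E → ℝ} (hm : Measurable h)
    (hi : Integrable (fun z => h (initialSegment n z, z n)) Q) :
    Q[fun z => h (initialSegment n z, z n) | initialFiltration E n] =ᵐ[Q]
      fun z => ∫ x, h (initialSegment n z, x) ∂κ n (initialSegment n z) := by
  have hcond := ae_of_ae_map (measurable_initialSegment n).aemeasurable
    (condDistrib_ae_eq_of_measure_eq_compProd _ (measurable_pi_apply n).aemeasurable
      (hQ n).map_eq)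
  filter_upwards [condExp_prod_ae_eq_integral_condDistrib (measurable_initialSegment n)
    (measurable_pi_apply n).aemeasurable hm.stronglyMeasurable hi, hcond] with z h1 h2
  exact h1.trans (by rw [h2])

end Chain

/-! ### The strong law for chains -/

section Truncation

lemma sum_ite_sq_div_sq_le {g : ℝ} (hg : 0 ≤ g) (n : ℕ) :
    ∑ i ∈ Finset.range n, (if g ≤ i then g ^ 2 else 0) / (i + 1 : ℝ) ^ 2 ≤
      if g ≤ n then g - g ^ 2 / n else 0 := by
  induction n with
  | zero =>
    split_ifs <;> simp [hg]
  | succ n ih =>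
    rw [Finset.sum_range_succ]
    push_cast
    by_cases hn : g ≤ n
    · rw [if_pos hn] at ih ⊢
      rw [if_pos (by linarith)]
      rcases n.eq_zero_or_pos with rfl | hn0
      · obtain rfl : g = 0 := le_antisymm (by simpa using hn) hg
        simp
      · have h : 1 / (n + 1 : ℝ) ^ 2 ≤ 1 / n - 1 / (n + 1) := by
          rw [div_sub_div _ _ (by positivity) (by positivity), div_le_div_iff₀ (by positivity)
            (by positivity)]
          nlinarith
        have := mul_le_mul_of_nonneg_left h (sq_nonneg g)
        ring_nf at ih this ⊢
        linarith
    · rw [if_neg hn] at ih ⊢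
      rw [zero_div, add_zero]
      refine ih.trans ?_
      split_ifs with h
      · rw [sub_nonneg, div_le_iff₀ (by positivity)]
        nlinarith
      · rfl

lemma tsum_indicator_natCast_lt_le (g : ℝ) :
    ∑' n : ℕ, {n : ℕ | (n : ℝ) < g}.indicator (1 : ℕ → ℝ≥0∞) n ≤ ‖g‖ₑ + 1 := by
  have hmem (n : ℕ) : n ∈ {n : ℕ | (n : ℝ) < g} ↔ n ∈ Finset.range ⌈g⌉₊ := by simp [Nat.lt_ceil]
  calc ∑' n : ℕ, {n : ℕ | (n : ℝ) < g}.indicator (1 : ℕ → ℝ≥0∞) n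
      = ∑ n ∈ Finset.range ⌈g⌉₊, {n : ℕ | (n : ℝ) < g}.indicator (1 : ℕ → ℝ≥0∞) n :=
        tsum_eq_sum fun n hn => Set.indicator_of_notMem (mt (hmem n).1 hn) _
    _ = ∑ n ∈ Finset.range ⌈g⌉₊, 1 :=
        Finset.sum_congr rfl fun n hn => Set.indicator_of_mem ((hmem n).2 hn) _
    _ = ENNReal.ofReal ⌈g⌉₊ := by simp
    _ ≤ ENNReal.ofReal (|g| + 1) := ENNReal.ofReal_le_ofReal <|
        (Nat.cast_le.2 (Nat.ceil_mono (le_abs_self g))).trans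
          (Nat.ceil_lt_add_one (abs_nonneg g)).le
    _ = ‖g‖ₑ + 1 := by
        rw [ENNReal.ofReal_add (abs_nonneg g) zero_le_one, ENNReal.ofReal_one,
          Real.enorm_eq_ofReal_abs]

variable {E : Type*} [MeasurableSpace E] {θ : Measure E} {G : E → ℝ}

lemma tendsto_setIntegral_natCast_lt (hG : Measurable G) (hi : Integrable G θ) :
    Tendsto (fun n : ℕ => ∫ x in {x | (n : ℝ) < G x}, G x ∂θ) atTop (𝓝 0) := by
  have h := Antitone.tendsto_setIntegral (s := fun n : ℕ => {x | (n : ℝ) < G x})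
    (fun n => measurableSet_lt measurable_const hG)
    (fun m n hmn x (hx : (n : ℝ) < G x) => lt_of_le_of_lt (Nat.cast_le.2 hmn) hx) hi.integrableOn
  have hempty : ⋂ n : ℕ, {x | (n : ℝ) < G x} = ∅ := by
    refine Set.eq_empty_of_forall_notMem fun x hx => ?_
    obtain ⟨n, hn⟩ := exists_nat_ge (G x)
    exact (Set.mem_iInter.1 hx n).not_ge hn
  simpa [hempty] using h

lemma abs_setIntegral_le_setIntegral_lt_of_integral_eq_zero (hG : Measurable G)
    (hi : Integrable G θ) {ν : Measure E} (hν : ν ≤ θ) {f : E → ℝ}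
    (hf : AEStronglyMeasurable f ν) (hfG : ∀ x, |f x| ≤ G x) (hf0 : ∫ x, f x ∂ν = 0) (c : ℝ) :
    |∫ x in {x | G x ≤ c}, f x ∂ν| ≤ ∫ x in {x | c < G x}, G x ∂θ := by
  have hfi : Integrable f ν := (hi.mono_measure hν).mono' hf (ae_of_all _ hfG)
  have hcompl : {x | G x ≤ c}ᶜ = {x | c < G x} := by ext; simp
  have hsplit := integral_add_compl (measurableSet_le hG (measurable_const (a := c))) hfi
  rw [hf0, hcompl] at hsplit
  rw [eq_neg_of_add_eq_zero_left hsplit, abs_neg]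
  calc |∫ x in {x | c < G x}, f x ∂ν| ≤ ∫ x in {x | c < G x}, G x ∂ν :=
        norm_integral_le_of_norm_le (f := f) (hi.mono_measure hν).integrableOn (ae_of_all _ hfG)
    _ ≤ ∫ x in {x | c < G x}, G x ∂θ := by
        refine integral_mono_measure (Measure.restrict_mono le_rfl hν) (ae_of_all _ fun x => ?_)
          hi.integrableOn
        exact (abs_nonneg _).trans (hfG x)

variable [IsFiniteMeasure θ]

lemma tsum_measure_natCast_lt_ne_top (hG : Measurable G) (hi : Integrable G θ) :
    ∑' n : ℕ, θ {x | (n : ℝ) < G x} ≠ ∞ := by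
  have hm (n : ℕ) : MeasurableSet {x | (n : ℝ) < G x} := measurableSet_lt measurable_const hG
  refine ne_top_of_le_ne_top (b := ∫⁻ x, (‖G x‖ₑ + 1) ∂θ) ?_ ?_
  · rw [lintegral_add_right _ measurable_const]
    exact ENNReal.add_ne_top.2 ⟨hi.hasFiniteIntegral.ne, by simp⟩
  · simp only [← fun n => lintegral_indicator_one (μ := θ) (hm n)]
    rw [← lintegral_tsum fun n => (measurable_one.indicator (hm n)).aemeasurable]
    exact lintegral_mono fun x => tsum_indicator_natCast_lt_le (G x)

lemma integrable_indicator_sq (hG : Measurable G) (hG0 : 0 ≤ G) (c : ℝ) :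
    Integrable ({x | G x ≤ c}.indicator fun x => G x ^ 2) θ := by
  refine Integrable.of_bound ((hG.pow_const 2).indicator
    (measurableSet_le hG measurable_const)).aestronglyMeasurable (c ^ 2) (ae_of_all _ fun x => ?_)
  by_cases hx : G x ≤ c
  · simpa [Set.indicator, hx] using pow_le_pow_left₀ (hG0 x) hx 2
  · simp [Set.indicator, hx, sq_nonneg]

lemma summable_integral_indicator_sq_div (hG : Measurable G) (hG0 : 0 ≤ G) (hi : Integrable G θ) :
    Summable fun n : ℕ => (∫ x, {x | G x ≤ n}.indicator (fun x => G x ^ 2) x ∂θ) /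
      (n + 1 : ℝ) ^ 2 := by
  have hint (n : ℕ) := integrable_indicator_sq (θ := θ) hG hG0 n
  refine summable_of_sum_range_le (c := ∫ x, G x ∂θ) (fun n => div_nonneg (integral_nonneg fun x =>
    Set.indicator_nonneg (fun _ _ => sq_nonneg _) x) (by positivity)) fun n => ?_
  simp only [← integral_div]
  rw [← integral_finsetSum _ fun i _ => (hint i).div_const _]
  refine integral_mono (integrable_finsetSum _ fun i _ => (hint i).div_const _) hi fun x => ?_
  refine (sum_ite_sq_div_sq_le (hG0 x) n).trans ?_
  split_ifs
  · exact sub_le_self _ (by positivity)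
  · exact hG0 x

end Truncation

section StrongLaw

variable {E : Type*} [MeasurableSpace E] {κ : (n : ℕ) → Kernel (Fin n → E) E}
  [∀ n, IsMarkovKernel (κ n)] {Q : Measure (ℕ → E)} [IsProbabilityMeasure Q]
  {θ : Measure E} [IsFiniteMeasure θ] {G : E → ℝ}

lemma IsChainLaw.ae_eventually_le (hQ : IsChainLaw Q κ) (hκ : ∀ n p, κ n p ≤ θ)
    (hG : Measurable G) (hi : Integrable G θ) : ∀ᵐ z ∂Q, ∀ᶠ n : ℕ in atTop, G (z n) ≤ n := by
  have hsum : ∑' n : ℕ, Q {z | (n : ℝ) < G (z n)} ≠ ∞ := by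
    refine ne_top_of_le_ne_top (tsum_measure_natCast_lt_ne_top hG hi)
      (ENNReal.tsum_le_tsum fun n => ?_)
    have hm : MeasurableSet {x | (n : ℝ) < G x} := measurableSet_lt measurable_const hG
    calc Q {z | (n : ℝ) < G (z n)} = Q.map (fun z => z n) {x | (n : ℝ) < G x} := by
          rw [Measure.map_apply (measurable_pi_apply n) hm]; rfl
      _ ≤ θ {x | (n : ℝ) < G x} := hQ.map_le (hκ n) _
  filter_upwards [ae_eventually_notMem hsum] with z hz
  filter_upwards [hz] with n hn using not_lt.1 hn

variable {D : (n : ℕ) → (Fin n → E) × E → ℝ}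

lemma IsChainLaw.summable_integral_sq_truncated (hQ : IsChainLaw Q κ) (hκ : ∀ n p, κ n p ≤ θ)
    (hG : Measurable G) (hG0 : 0 ≤ G) (hi : Integrable G θ) (hDG : ∀ n q, |D n q| ≤ G q.2) :
    Summable fun n : ℕ =>
      (∫ z, {q : _ × E | G q.2 ≤ n}.indicator (D n) (initialSegment n z, z n) ^ 2 ∂Q) /
        (n + 1 : ℝ) ^ 2 := by
  refine (summable_integral_indicator_sq_div hG hG0 hi).of_nonneg_of_le (fun n => by positivity)
    fun n => ?_
  gcongr
  set f : E → ℝ := {x | G x ≤ n}.indicator fun x => G x ^ 2 with hf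
  have hfi : Integrable f θ := integrable_indicator_sq hG hG0 n
  have hf0 (x : E) : 0 ≤ f x := Set.indicator_nonneg (fun _ _ => sq_nonneg _) x
  have hle := hQ.map_le (hκ n)
  have hfm : AEStronglyMeasurable f (Q.map fun z => z n) :=
    (hfi.mono_measure hle).aestronglyMeasurable
  calc _ ≤ ∫ z, f (z n) ∂Q := by
        refine integral_mono_of_nonneg (ae_of_all _ fun z => sq_nonneg _)
          ((hfi.mono_measure hle).comp_measurable (measurable_pi_apply n)) (ae_of_all _ fun z => ?_)
        by_cases hz : G (z n) ≤ n
        · simpa [hf, hz] using sq_le_sq' (abs_le.1 (hDG n _)).1 (abs_le.1 (hDG n _)).2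
        · simp [hf, hz]
    _ = ∫ x, f x ∂Q.map fun z => z n :=
      (integral_map (measurable_pi_apply n).aemeasurable hfm).symm
    _ ≤ ∫ x, f x ∂θ := integral_mono_measure hle (ae_of_all _ hf0) hfi

lemma IsChainLaw.ae_tendsto_average_truncated_sub [StandardBorelSpace E] [Nonempty E]
    (hQ : IsChainLaw Q κ) (hκ : ∀ n p, κ n p ≤ θ)
    (hG : Measurable G) (hG0 : 0 ≤ G) (hi : Integrable G θ) (hD : ∀ n, Measurable (D n))
    (hDG : ∀ n q, |D n q| ≤ G q.2) :
    ∀ᵐ z ∂Q, Tendsto (fun n : ℕ => (∑ i ∈ Finset.range n,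
      ({q : _ × E | G q.2 ≤ i}.indicator (D i) (initialSegment i z, z i) -
        ∫ x in {x | G x ≤ i}, D i (initialSegment i z, x) ∂κ i (initialSegment i z))) / n)
      atTop (𝓝 0) := by
  set T : (n : ℕ) → (Fin n → E) × E → ℝ := fun n => {q | G q.2 ≤ n}.indicator (D n) with hT
  have hTm (n : ℕ) : Measurable (T n) :=
    (hD n).indicator (measurableSet_le (by fun_prop) measurable_const)
  have hTb (n : ℕ) (q) : ‖T n q‖ ≤ n := by
    by_cases hq : G q.2 ≤ n
    · simpa [hT, hq] using (hDG n q).trans hq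
    · simp [hT, hq]
  set ξ : ℕ → (ℕ → E) → ℝ := fun n z => T n (initialSegment n z, z n)
  have hξ2 (n : ℕ) : MemLp (ξ n) 2 Q := .of_bound
    ((hTm n).comp (measurable_initialSegment_prodMk n)).aestronglyMeasurable n
    (ae_of_all _ fun z => hTb n _)
  have hcond := ae_all_iff.2 fun n => hQ.condExp_ae_eq (hTm n) ((hξ2 n).integrable one_le_two)
  filter_upwards [hcond, ae_tendsto_average_sub_condExp (ξ := ξ) (ℱ := initialFiltration E)
    (fun n => ((hTm n).comp (measurable_initialFiltration_prodMk n)).stronglyMeasurable) hξ2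
    (hQ.summable_integral_sq_truncated hκ hG hG0 hi hDG)] with z hz h
  refine h.congr fun n => ?_
  congr! 3 with i
  rw [hz i, ← integral_indicator (measurableSet_le hG measurable_const)]
  rfl

theorem IsChainLaw.ae_tendsto_average [StandardBorelSpace E] [Nonempty E] (hQ : IsChainLaw Q κ)
    (hκ : ∀ n p, κ n p ≤ θ) (hG : Measurable G) (hi : Integrable G θ)
    (hD : ∀ n, Measurable (D n)) (hDG : ∀ n q, |D n q| ≤ G q.2)
    (hD0 : ∀ n p, ∫ x, D n (p, x) ∂κ n p = 0) :
    ∀ᵐ z ∂Q, Tendsto (fun n : ℕ => (∑ i ∈ Finset.range n, D i (initialSegment i z, z i)) / n)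
      atTop (𝓝 0) := by
  have hG0 : 0 ≤ G := fun x => (abs_nonneg _).trans (hDG 0 (Fin.elim0, x))
  have hDp (n p) : Measurable fun x => D n (p, x) := (hD n).comp measurable_prodMk_left
  filter_upwards [hQ.ae_tendsto_average_truncated_sub hκ hG hG0 hi hD hDG,
    hQ.ae_eventually_le hκ hG hi] with z htrunc hle
  set τ : ℕ → ℝ := fun n =>
    ∫ x in {x | G x ≤ n}, D n (initialSegment n z, x) ∂κ n (initialSegment n z)
  have hτ : Tendsto τ atTop (𝓝 0) := squeeze_zero_norm
    (fun n => abs_setIntegral_le_setIntegral_lt_of_integral_eq_zero hG hi (hκ n _)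
      (hDp n _).aestronglyMeasurable (fun x => hDG n (_, x)) (hD0 n _) n)
    (tendsto_setIntegral_natCast_lt hG hi)
  set ρ : ℕ → ℝ := fun n => D n (initialSegment n z, z n) -
    {q : _ × E | G q.2 ≤ n}.indicator (D n) (initialSegment n z, z n)
  have hρ : Tendsto ρ atTop (𝓝 0) := by
    refine tendsto_const_nhds.congr' ?_
    filter_upwards [hle] with n hn
    simp [ρ, hn]
  have := htrunc.add (hτ.add hρ).cesaro
  simp only [add_zero] at this
  refine this.congr fun n => ?_
  rw [← div_eq_inv_mul, ← add_div, ← Finset.sum_add_distrib]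
  congr! 2 with i
  ring

end StrongLaw

/-! ### Uniform integrability -/

section UniformIntegrability

variable {α : Type*} {m : MeasurableSpace α} {Pfam : Set (Measure α)} {f : α → ℝ}

/-- Uniform integrability of a single function with respect to a family of measures. It is
expressed through the excess `(|f| - c)⁺`; `ENNReal.ofReal` takes the positive part. -/
def UniformlyIntegrable (Pfam : Set (Measure α)) (f : α → ℝ) : Prop :=
  Tendsto (fun c : ℝ => ⨆ P ∈ Pfam, ∫⁻ x, ENNReal.ofReal (|f x| - c) ∂P) atTop (𝓝 0)

namespace UniformlyIntegrable

lemma neg (h : UniformlyIntegrable Pfam f) : UniformlyIntegrable Pfam (-f) := by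
  simpa only [UniformlyIntegrable, Pi.neg_apply, abs_neg] using h

lemma eventually_forall_lintegral_lt (h : UniformlyIntegrable Pfam f) {ε : ℝ≥0∞} (hε : 0 < ε) :
    ∀ᶠ c : ℝ in atTop, ∀ P ∈ Pfam, ∫⁻ x, ENNReal.ofReal (|f x| - c) ∂P < ε := by
  filter_upwards [h.eventually_lt_const hε] with c hc P hP
  exact (le_iSup₂ (f := fun (P : Measure α) (_ : P ∈ Pfam) =>
    ∫⁻ x, ENNReal.ofReal (|f x| - c) ∂P) P hP).trans_lt hc

lemma integrable (h : UniformlyIntegrable Pfam f) (hf : Measurable f) {P : Measure α}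
    [IsFiniteMeasure P] (hP : P ∈ Pfam) : Integrable f P := by
  obtain ⟨c, hc⟩ := (h.eventually_forall_lintegral_lt zero_lt_one).exists
  refine ⟨hf.aestronglyMeasurable, ?_⟩
  calc ∫⁻ x, ‖f x‖ₑ ∂P
      ≤ ∫⁻ x, (ENNReal.ofReal (|f x| - c) + ENNReal.ofReal c) ∂P := by
        refine lintegral_mono fun x => ?_
        rw [Real.enorm_eq_ofReal_abs]
        simpa using ENNReal.ofReal_add_le (p := |f x| - c) (q := c)
    _ = ∫⁻ x, ENNReal.ofReal (|f x| - c) ∂P + ENNReal.ofReal c * P Set.univ := by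
        rw [lintegral_add_right _ measurable_const, lintegral_const]
    _ < ⊤ := ENNReal.add_lt_top.2 ⟨(hc P hP).trans ENNReal.one_lt_top,
        ENNReal.mul_lt_top ENNReal.ofReal_lt_top (measure_lt_top P _)⟩

end UniformlyIntegrable

lemma enorm_sub_clip_le (x : ℝ) {c : ℝ} (hc : 0 ≤ c) :
    ‖x - max (-c) (min x c)‖ₑ ≤ ENNReal.ofReal (|x| - c) := by
  have clip_error : |x - max (-c) (min x c)| ≤ max (|x| - c) 0 := by grind
  calc ‖x - max (-c) (min x c)‖ₑ = ENNReal.ofReal |x - max (-c) (min x c)| :=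
        Real.enorm_eq_ofReal_abs _
    _ ≤ ENNReal.ofReal (max (|x| - c) 0) := ENNReal.ofReal_le_ofReal clip_error
    _ = ENNReal.ofReal (|x| - c) := by simp [ENNReal.ofReal_max]

lemma abs_clip_le (x c : ℝ) : |max (-c) (min x c)| ≤ |c| := by grind

lemma integrable_clip {P : Measure α} [IsFiniteMeasure P] (hf : Measurable f) (c : ℝ) :
    Integrable (fun x => max (-c) (min (f x) c)) P :=
  .of_bound (by fun_prop) |c| (ae_of_all _ fun x => abs_clip_le (f x) c)

lemma UniformlyIntegrable.tendstoUniformlyOn_integral_clip (h : UniformlyIntegrable Pfam f)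
    (hf : Measurable f) (hfin : ∀ P ∈ Pfam, IsFiniteMeasure P) :
    TendstoUniformlyOn (fun (c : ℝ) (P : Measure α) => ∫ x, max (-c) (min (f x) c) ∂P)
      (fun P => ∫ x, f x ∂P) atTop Pfam := by
  refine EMetric.tendstoUniformlyOn_iff.2 fun ε hε => ?_
  filter_upwards [h.eventually_forall_lintegral_lt hε, eventually_ge_atTop 0] with c hc hc0 P hP
  have := hfin P hP
  calc edist (∫ x, f x ∂P) (∫ x, max (-c) (min (f x) c) ∂P)
      = ‖∫ x, (f x - max (-c) (min (f x) c)) ∂P‖ₑ := by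
        rw [edist_eq_enorm_sub, integral_sub (h.integrable hf hP) (integrable_clip hf c)]
    _ ≤ ∫⁻ x, ‖f x - max (-c) (min (f x) c)‖ₑ ∂P := enorm_integral_le_lintegral_enorm _
    _ ≤ ∫⁻ x, ENNReal.ofReal (|f x| - c) ∂P :=
        lintegral_mono fun x => enorm_sub_clip_le (f x) hc0
    _ < ε := hc P hP

lemma lintegral_excess_eq {P : Measure α} (hf : AEMeasurable f P) (c : ℝ) :
    ∫⁻ x, ENNReal.ofReal (|f x| - c) ∂P = ∫⁻ t in Set.Ioi c, P {x | t ≤ |f x|} := by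
  calc ∫⁻ x, ENNReal.ofReal (|f x| - c) ∂P
      = ∫⁻ x, ENNReal.ofReal (max (|f x| - c) 0) ∂P := by simp [ENNReal.ofReal_max]
    _ = ∫⁻ t in Set.Ioi 0, P {x | t ≤ max (|f x| - c) 0} :=
        lintegral_eq_lintegral_meas_le P (ae_of_all _ fun x => le_max_right _ _) (by fun_prop)
    _ = ∫⁻ t in Set.Ioi 0, P {x | t + c ≤ |f x|} :=
        setLIntegral_congr_fun measurableSet_Ioi fun t ht => by
          simp [le_sub_iff_add_le, not_le.2 (Set.mem_Ioi.1 ht)]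
    _ = ∫⁻ t in Set.Ioi c, P {x | t ≤ |f x|} := by
        rw [← lintegral_indicator measurableSet_Ioi, ← lintegral_indicator measurableSet_Ioi,
          ← lintegral_add_right_eq_self ((Set.Ioi c).indicator _) c]
        simp [Set.indicator]

lemma tendsto_setLIntegral_Ioi {g : ℝ → ℝ≥0∞} {a : ℝ} (hg : ∫⁻ t in Set.Ioi a, g t ≠ ⊤) :
    Tendsto (fun c => ∫⁻ t in Set.Ioi c, g t) atTop (𝓝 0) := by
  let ρ : Measure ℝ := (volume.restrict (Set.Ioi a)).withDensity g
  have tail_eq {c : ℝ} (hc : a ≤ c) : ρ (Set.Ioi c) = ∫⁻ t in Set.Ioi c, g t := by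
    rw [withDensity_apply _ measurableSet_Ioi, Measure.restrict_restrict measurableSet_Ioi,
      Set.inter_eq_left.2 (Set.Ioi_subset_Ioi hc)]
  have inter_eq : ⋂ c : ℝ, Set.Ioi c = ∅ := by
    simpa only [Set.eq_empty_iff_forall_notMem, Set.mem_iInter, not_forall, Set.mem_Ioi, not_lt]
      using fun x => ⟨x, le_rfl⟩
  have h : Tendsto (fun c : ℝ => ρ (Set.Ioi c)) atTop (𝓝 (ρ (⋂ c : ℝ, Set.Ioi c))) :=
    tendsto_measure_iInter_atTop (fun c => measurableSet_Ioi.nullMeasurableSet)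
      (fun _ _ hab => Set.Ioi_subset_Ioi hab) ⟨a, by rwa [tail_eq le_rfl]⟩
  rw [inter_eq, measure_empty] at h
  exact h.congr' ((eventually_ge_atTop a).mono fun c hc => tail_eq hc)

end UniformIntegrability

/-! ### Sub-linear expectations -/

namespace SublinearExpectationSpace

section Basic

variable {Ω : Type*} [MeasurableSpace Ω] {S : SublinearExpectationSpace Ω} {Y Z : Ω → ℝ}

lemma comp_mem_of_lipschitzWith {n : ℕ} {φ : (Fin n → ℝ) → ℝ} {K : NNReal}
    (h : LipschitzWith K φ) {X : Fin n → Ω → ℝ} (hX : ∀ i, X i ∈ S.H) :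
    (fun ω => φ fun i => X i ω) ∈ S.H := by
  refine S.comp_mem n X hX φ ⟨K + 1, by positivity, 0, fun x y => ?_⟩
  calc |φ x - φ y| ≤ K * ‖x - y‖ := by
        simpa only [← Real.norm_eq_abs, ← dist_eq_norm] using h.dist_le_mul x y
    _ ≤ (K + 1) * (1 + ‖x‖ ^ 0 + ‖y‖ ^ 0) * ‖x - y‖ := by
        refine mul_le_mul_of_nonneg_right ?_ (norm_nonneg _)
        linarith [K.coe_nonneg, pow_zero ‖x‖, pow_zero ‖y‖]

lemma comp_mem_Hb {n : ℕ} {φ : (Fin n → ℝ) → ℝ} (h : IsBddLip φ) {X : Fin n → Ω → ℝ}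
    (hX : ∀ i, X i ∈ S.H) : (fun ω => φ fun i => X i ω) ∈ S.Hb := by
  obtain ⟨⟨M, hM⟩, K, hK⟩ := h
  exact ⟨comp_mem_of_lipschitzWith hK hX, M, fun ω => hM _⟩

lemma real_comp_mem_of_lipschitzWith {f : ℝ → ℝ} {K : NNReal} (h : LipschitzWith K f)
    (hZ : Z ∈ S.H) : (fun ω => f (Z ω)) ∈ S.H :=
  comp_mem_of_lipschitzWith (φ := fun x : Fin 1 → ℝ => f (x 0))
    (h.comp (LipschitzWith.eval (α := fun _ : Fin 1 => ℝ) 0)) (X := fun _ => Z) fun _ => hZ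

lemma real_comp_mem_Hb {f : ℝ → ℝ} (hf : IsBddLip f) (hZ : Z ∈ S.H) :
    (fun ω => f (Z ω)) ∈ S.Hb := by
  obtain ⟨⟨M, hM⟩, K, hK⟩ := hf
  exact ⟨real_comp_mem_of_lipschitzWith hK hZ, M, fun ω => hM _⟩

lemma clip_mem_Hb (hZ : Z ∈ S.H) (c : ℝ) : (fun ω => max (-c) (min (Z ω) c)) ∈ S.Hb :=
  ⟨real_comp_mem_of_lipschitzWith (f := fun x => max (-c) (min x c))
      ((LipschitzWith.id.min_const c).const_max (-c)) hZ, |c|,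
    fun ω => abs_clip_le (Z ω) c⟩

lemma const_mem (c : ℝ) : (fun _ => c) ∈ S.H :=
  comp_mem_of_lipschitzWith (φ := fun _ : Fin 0 → ℝ => c) (LipschitzWith.const c)
    (X := fun _ _ => 0) fun i => i.elim0

lemma E_le_of_le (hY : Y ∈ S.H) {c : ℝ} (h : ∀ ω, Y ω ≤ c) : S.E Y ≤ c :=
  (S.mono _ (const_mem c) _ hY h).trans_eq (S.const c)

lemma le_E_of_le (hY : Y ∈ S.H) {c : ℝ} (h : ∀ ω, c ≤ Y ω) : c ≤ S.E Y :=
  (S.const c).symm.trans_le (S.mono _ hY _ (const_mem c) h)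

lemma coe_toReal_E (hY : Y ∈ S.Hb) : ((S.E Y).toReal : EReal) = S.E Y := by
  obtain ⟨hY, M, hM⟩ := hY
  exact EReal.coe_toReal
    (ne_top_of_le_ne_top (EReal.coe_ne_top M) (E_le_of_le hY fun ω => (abs_le.1 (hM ω)).2))
    (ne_bot_of_le_ne_bot (EReal.coe_ne_bot (-M)) (le_E_of_le hY fun ω => (abs_le.1 (hM ω)).1))

lemma abs_toReal_E_le (hY : Y ∈ S.H) {c : ℝ} (h : ∀ ω, |Y ω| ≤ c) : |(S.E Y).toReal| ≤ c := by
  rw [abs_le, ← EReal.coe_le_coe_iff, ← EReal.coe_le_coe_iff, coe_toReal_E ⟨hY, c, h⟩]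
  exact ⟨le_E_of_le hY fun ω => (abs_le.1 (h ω)).1, E_le_of_le hY fun ω => (abs_le.1 (h ω)).2⟩

lemma toReal_E_le_add (hY : Y ∈ S.Hb) (hZ : Z ∈ S.Hb) {ε : ℝ} (h : ∀ ω, Y ω ≤ Z ω + ε) :
    (S.E Y).toReal ≤ (S.E Z).toReal + ε := by
  have hε : S.E (fun _ => ε) = (ε : EReal) := S.const ε
  have : S.E Y ≤ S.E Z + ε :=
    calc S.E Y ≤ S.E (Z + fun _ => ε) := S.mono _ (S.H.add_mem hZ.1 (const_mem ε)) _ hY.1 h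
      _ ≤ S.E Z + S.E (fun _ => ε) :=
        S.subadd _ hZ.1 _ (const_mem ε) (by simp [hε]) (by simp [hε])
      _ = S.E Z + ε := by rw [hε]
  rw [← coe_toReal_E hY, ← coe_toReal_E hZ] at this
  exact_mod_cast this

lemma measurable_sigmaH (hY : Y ∈ S.H) : Measurable[S.sigmaH] Y :=
  (comap_measurable Y).mono
    (le_iSup₂ (f := fun Z (_ : Z ∈ S.H) => MeasurableSpace.comap Z (borel ℝ)) Y hY) le_rfl

lemma measurable_sigmaH_pi {X : ℕ → Ω → ℝ} (hX : ∀ i, X i ∈ S.H) :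
    Measurable[S.sigmaH] fun ω i => X i ω :=
  @measurable_pi_lambda _ _ _ S.sigmaH _ _ fun i => measurable_sigmaH (hX i)

lemma integrable_of_mem_Hb {P : @Measure Ω S.sigmaH} [IsFiniteMeasure P] (hY : Y ∈ S.Hb) :
    Integrable Y P := by
  obtain ⟨hY, M, hM⟩ := hY
  exact .of_bound (measurable_sigmaH hY).aestronglyMeasurable M (ae_of_all _ hM)

lemma upperCapacity_le_toENNReal_E {A : Set Ω} (hY : Y ∈ S.H) (hA : ∀ ω ∈ A, 1 ≤ Y ω)
    (h0 : ∀ ω, 0 ≤ Y ω) : S.upperCapacity A ≤ (S.E Y).toENNReal :=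
  iInf_le_of_le Y (iInf₂_le hY fun ω => Set.indicator_apply_le' (hA ω) fun _ => h0 ω)

lemma upperCapacity_univ_le : S.upperCapacity Set.univ ≤ 1 := by
  calc S.upperCapacity Set.univ ≤ (S.E fun _ => 1).toENNReal :=
        upperCapacity_le_toENNReal_E (const_mem 1) (fun _ _ => le_rfl) fun _ => zero_le_one
    _ = 1 := by rw [S.const 1, EReal.toENNReal_of_ne_top (EReal.coe_ne_top 1)]; simp

lemma upperCapacity_empty : S.upperCapacity ∅ = 0 := by
  simpa [S.const] using
    upperCapacity_le_toENNReal_E (S := S) (A := ∅) (const_mem 0) (by simp) fun _ => le_rfl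

lemma outerCapacity_le_one (A : Set Ω) : S.outerCapacity A ≤ 1 := by
  let B : ℕ → Set Ω := fun n => if n = 0 then Set.univ else ∅
  have measurable : ∀ n, MeasurableSet (B n) := fun n => by
    by_cases h : n = 0 <;> simp [B, h]
  have cover : A ⊆ ⋃ n, B n := fun ω _ => Set.mem_iUnion.2 ⟨0, by simp [B]⟩
  calc S.outerCapacity A ≤ ∑' n, S.upperCapacity (B n) :=
        iInf_le_of_le B (iInf₂_le measurable cover)
    _ = S.upperCapacity Set.univ :=
        tsum_eq_single 0 fun n hn => by simp [B, hn, upperCapacity_empty]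
    _ ≤ 1 := upperCapacity_univ_le

end Basic

namespace CC

variable {Ω : Type*} [MeasurableSpace Ω] {S : SublinearExpectationSpace Ω}
  {Pfam : Set (@Measure Ω S.sigmaH)} {P : @Measure Ω S.sigmaH} {Y Z : Ω → ℝ}

lemma integral_le_E (hCC : S.CC Pfam) (hP : P ∈ Pfam) (hY : Y ∈ S.Hb) :
    ((∫ ω, Y ω ∂P : ℝ) : EReal) ≤ S.E Y := by
  rw [hCC.representation Y hY]
  exact le_iSup₂ (f := fun (P : @Measure Ω S.sigmaH) (_ : P ∈ Pfam) =>
    ((∫ ω, Y ω ∂P : ℝ) : EReal)) P hP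

lemma integral_le_toReal_E (hCC : S.CC Pfam) (hP : P ∈ Pfam) (hY : Y ∈ S.Hb) :
    ∫ ω, Y ω ∂P ≤ (S.E Y).toReal := by
  rw [← EReal.coe_le_coe_iff, coe_toReal_E hY]
  exact hCC.integral_le_E hP hY

lemma exists_lt_integral (hCC : S.CC Pfam) (hY : Y ∈ S.Hb) {a : ℝ}
    (ha : a < (S.E Y).toReal) : ∃ P ∈ Pfam, a < ∫ ω, Y ω ∂P := by
  rw [← EReal.coe_lt_coe_iff, coe_toReal_E hY, hCC.representation Y hY] at ha
  obtain ⟨P, hP⟩ := lt_iSup_iff.1 ha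
  obtain ⟨hP, h⟩ := lt_iSup_iff.1 hP
  exact ⟨P, hP, EReal.coe_lt_coe_iff.1 h⟩

lemma nonempty (hCC : S.CC Pfam) : Pfam.Nonempty := by
  obtain ⟨P, hP, -⟩ := hCC.exists_lt_integral (a := -1) (Y := fun _ => 0)
    ⟨const_mem 0, 0, by simp⟩ (by simp [S.const 0])
  exact ⟨P, hP⟩

lemma measure_le_upperCapacity (hCC : S.CC Pfam) (hP : P ∈ Pfam) (A : Set Ω) :
    P A ≤ S.upperCapacity A := by
  have := hCC.isProbability P hP
  refine le_iInf fun ξ => le_iInf₂ fun hξ hA => ?_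
  have nonneg : ∀ ω, 0 ≤ min (ξ ω) 1 := fun ω =>
    le_min ((Set.indicator_nonneg (fun _ _ => zero_le_one) ω).trans (hA ω)) zero_le_one
  have mem_H : (fun ω => min (ξ ω) 1) ∈ S.H :=
    real_comp_mem_of_lipschitzWith (LipschitzWith.id.min_const 1) hξ
  have mem_Hb : (fun ω => min (ξ ω) 1) ∈ S.Hb :=
    ⟨mem_H, 1, fun ω => (abs_of_nonneg (nonneg ω)).trans_le (min_le_right _ _)⟩
  calc P A ≤ P {ω | 1 ≤ ENNReal.ofReal (min (ξ ω) 1)} := measure_mono fun ω hω => by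
        simpa [Set.indicator_of_mem hω] using hA ω
    _ ≤ ∫⁻ ω, ENNReal.ofReal (min (ξ ω) 1) ∂P := by
        simpa only [one_mul] using
          mul_meas_ge_le_lintegral (measurable_sigmaH mem_H).ennreal_ofReal 1
    _ = (((∫ ω, min (ξ ω) 1 ∂P : ℝ) : EReal)).toENNReal := by
        rw [← ofReal_integral_eq_lintegral_ofReal (integrable_of_mem_Hb mem_Hb)
          (ae_of_all _ nonneg), EReal.toENNReal_of_ne_top (EReal.coe_ne_top _), EReal.toReal_coe]
    _ ≤ (S.E ξ).toENNReal := EReal.toENNReal_le_toENNReal <|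
        (hCC.integral_le_E hP mem_Hb).trans (S.mono _ hξ _ mem_H fun ω => min_le_left _ _)

lemma upperCapacity_univ (hCC : S.CC Pfam) : S.upperCapacity Set.univ = 1 := by
  obtain ⟨P, hP⟩ := hCC.nonempty
  have := hCC.isProbability P hP
  exact upperCapacity_univ_le.antisymm
    (measure_univ.symm.trans_le (hCC.measure_le_upperCapacity hP _))

lemma outerCapacity_eq_one (hCC : S.CC Pfam) (hP : P ∈ Pfam) {A : Set Ω} (hA : P A = 1) :
    S.outerCapacity A = 1 := by
  refine (outerCapacity_le_one A).antisymm (le_iInf fun B => le_iInf₂ fun _ cover => ?_)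
  calc 1 = P A := hA.symm
    _ ≤ P (⋃ n, B n) := measure_mono cover
    _ ≤ ∑' n, P (B n) := measure_iUnion_le B
    _ ≤ ∑' n, S.upperCapacity (B n) :=
      ENNReal.tsum_le_tsum fun n => hCC.measure_le_upperCapacity hP _

lemma exists_tendsto_integral (hCC : S.CC Pfam) {W : ℕ → Ω → ℝ} (hW : ∀ k, W k ∈ S.Hb)
    {ι : Type*} (U : Ultrafilter ι) (R : ι → @Measure Ω S.sigmaH) (hR : ∀ i, R i ∈ Pfam) :
    ∃ P ∈ Pfam, ∀ k, Tendsto (fun i => ∫ ω, W k ω ∂(R i)) U (𝓝 (∫ ω, W k ω ∂P)) := by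
  have hm := measurable_sigmaH_pi fun k => (hW k).1
  have clip_eq (k : ℕ) : ∃ c, ∀ ω, max (-c) (min (W k ω) c) = W k ω := by
    obtain ⟨-, c, hc⟩ := hW k
    exact ⟨c, fun ω => by rw [min_eq_left (abs_le.1 (hc ω)).2, max_eq_right (abs_le.1 (hc ω)).1]⟩
  choose c hc using clip_eq
  let law (P : @Measure Ω S.sigmaH) : Measure (ℕ → ℝ) :=
    @Measure.map Ω (ℕ → ℝ) S.sigmaH _ (fun ω i => W i ω) P
  let f (k : ℕ) : BoundedContinuousFunction (ℕ → ℝ) ℝ := .ofNormedAddCommGroup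
    (fun y => max (-c k) (min (y k) (c k))) (by fun_prop) |c k| fun y => abs_clip_le (y k) (c k)
  have integral_law (k : ℕ) (P : @Measure Ω S.sigmaH) : ∫ y, f k y ∂(law P) = ∫ ω, W k ω ∂P := by
    rw [integral_map hm.aemeasurable (f k).continuous.measurable.aestronglyMeasurable]
    exact integral_congr_ae (ae_of_all _ (hc k))
  let ν (i : ι) : ProbabilityMeasure (ℕ → ℝ) :=
    have := hCC.isProbability (R i) (hR i)
    ⟨law (R i), Measure.isProbabilityMeasure_map hm.aemeasurable⟩
  obtain ⟨ν', ⟨P, hP, hν'⟩, hlim⟩ := (hCC.compact W hW).ultrafilter_le_nhds (U.map ν) <|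
    le_principal_iff.2 <| Ultrafilter.mem_map.2 <| univ_mem' fun i => ⟨R i, hR i, rfl⟩
  refine ⟨P, hP, fun k => ?_⟩
  rw [← integral_law, ← show (ν' : Measure (ℕ → ℝ)) = law P from hν']
  simpa only [ν, ProbabilityMeasure.coe_mk, integral_law] using
    ProbabilityMeasure.tendsto_iff_forall_integral_tendsto.1 hlim (f k)

lemma tendstoUniformlyOn_integral_clip (hCC : S.CC Pfam) (hZ : Z ∈ S.H)
    (hui : UniformlyIntegrable Pfam Z) :
    TendstoUniformlyOn (fun (c : ℝ) (P : @Measure Ω S.sigmaH) => ∫ ω, max (-c) (min (Z ω) c) ∂P)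
      (fun P => ∫ ω, Z ω ∂P) atTop Pfam :=
  hui.tendstoUniformlyOn_integral_clip (measurable_sigmaH hZ) fun P hP =>
    have := hCC.isProbability P hP
    inferInstance

lemma exists_tendsto_integral_of_uniformlyIntegrable (hCC : S.CC Pfam) (hZ : Z ∈ S.H)
    (hui : UniformlyIntegrable Pfam Z) {ι : Type*} (U : Ultrafilter ι)
    (R : ι → @Measure Ω S.sigmaH) (hR : ∀ i, R i ∈ Pfam) :
    ∃ P ∈ Pfam, Tendsto (fun i => ∫ ω, Z ω ∂(R i)) U (𝓝 (∫ ω, Z ω ∂P)) := by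
  have clip_mem (k : ℕ) := clip_mem_Hb hZ k
  obtain ⟨P, hP, hlim⟩ := hCC.exists_tendsto_integral clip_mem U R hR
  have uniform : TendstoUniformlyOn (fun (k : ℕ) (P : @Measure Ω S.sigmaH) =>
      ∫ ω, max (-k : ℝ) (min (Z ω) k) ∂P) (fun P => ∫ ω, Z ω ∂P) atTop Pfam := fun u hu =>
    tendsto_natCast_atTop_atTop.eventually (hCC.tendstoUniformlyOn_integral_clip hZ hui u hu)
  have uniform_R : TendstoUniformly (fun (k : ℕ) i => ∫ ω, max (-k : ℝ) (min (Z ω) k) ∂(R i))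
      (fun i => ∫ ω, Z ω ∂(R i)) atTop := fun u hu =>
    (uniform u hu).mono fun k hk i => hk (R i) (hR i)
  exact ⟨P, hP, uniform_R.tendsto_of_eventually_tendsto (.of_forall hlim) (uniform.tendsto_at hP)⟩

lemma isCompact_range_integral (hCC : S.CC Pfam) (hZ : Z ∈ S.H)
    (hui : UniformlyIntegrable Pfam Z) :
    IsCompact (Set.range fun P : Pfam => ∫ ω, Z ω ∂(P : @Measure Ω S.sigmaH)) := by
  refine isCompact_iff_ultrafilter_le_nhds.2 fun U hU => ?_
  rw [le_principal_iff, ← Set.image_univ] at hU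
  obtain ⟨P, hP, hlim⟩ := hCC.exists_tendsto_integral_of_uniformlyIntegrable hZ hui
    (Ultrafilter.ofComapInfPrincipal hU) Subtype.val fun P => P.2
  refine ⟨_, ⟨⟨P, hP⟩, rfl⟩, ?_⟩
  rw [← Ultrafilter.ofComapInfPrincipal_eq_of_map hU]
  exact hlim

lemma exists_forall_integral_le (hCC : S.CC Pfam) (hZ : Z ∈ S.H)
    (hui : UniformlyIntegrable Pfam Z) :
    ∃ P ∈ Pfam, ∀ P' ∈ Pfam, ∫ ω, Z ω ∂P' ≤ ∫ ω, Z ω ∂P := by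
  have := hCC.nonempty.to_subtype
  obtain ⟨_, ⟨P, rfl⟩, hP⟩ :=
    (hCC.isCompact_range_integral hZ hui).exists_isGreatest (Set.range_nonempty _)
  exact ⟨P, P.2, fun P' hP' => hP ⟨⟨P', hP'⟩, rfl⟩⟩

lemma exists_hasUpperMean (hCC : S.CC Pfam) (hZ : Z ∈ S.H) (hui : UniformlyIntegrable Pfam Z) :
    ∃ P ∈ Pfam, S.HasUpperMean Z (∫ ω, Z ω ∂P) := by
  obtain ⟨P, hP, hmax⟩ := hCC.exists_forall_integral_le hZ hui
  refine ⟨P, hP, ?_⟩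
  suffices Tendsto (fun c : ℝ => (S.E fun ω => max (-c) (min (Z ω) c)).toReal) atTop
      (𝓝 (∫ ω, Z ω ∂P)) from
    ((continuous_coe_real_ereal.tendsto _).comp this).congr fun c => coe_toReal_E (clip_mem_Hb hZ c)
  refine Metric.tendsto_nhds.2 fun ε hε => ?_
  have uniform := Metric.tendstoUniformlyOn_iff.1 (hCC.tendstoUniformlyOn_integral_clip hZ hui)
    (ε / 2) (half_pos hε)
  filter_upwards [uniform] with c hc
  have lower : ∫ ω, max (-c) (min (Z ω) c) ∂P ≤ (S.E fun ω => max (-c) (min (Z ω) c)).toReal :=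
    hCC.integral_le_toReal_E hP (clip_mem_Hb hZ c)
  have upper : (S.E fun ω => max (-c) (min (Z ω) c)).toReal ≤ ∫ ω, Z ω ∂P + ε / 2 := by
    by_contra! hlt
    obtain ⟨P', hP', h⟩ := hCC.exists_lt_integral (clip_mem_Hb hZ c) hlt
    linarith [hmax P' hP', (abs_lt.1 (hc P' hP')).1]
  rw [Real.dist_eq, abs_lt]
  constructor <;> linarith [(abs_lt.1 (hc P hP)).2]

lemma exists_hasLowerMean (hCC : S.CC Pfam) (hZ : Z ∈ S.H) (hui : UniformlyIntegrable Pfam Z) :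
    ∃ P ∈ Pfam, S.HasLowerMean Z (∫ ω, Z ω ∂P) := by
  obtain ⟨P, hP, h⟩ := hCC.exists_hasUpperMean (S.H.neg_mem hZ) hui.neg
  refine ⟨P, hP, ?_⟩
  simpa only [HasLowerMean, Pi.neg_apply, integral_neg] using h

lemma uniformlyIntegrable_of_choquet_lt_top (hCC : S.CC Pfam) (hZ : Z ∈ S.H)
    (h : S.choquet (fun ω => |Z ω|) < ⊤) : UniformlyIntegrable Pfam Z := by
  have lower_part : ∫⁻ t in Set.Iio (0 : ℝ), (1 - S.upperCapacity {ω | t ≤ |Z ω|}) = 0 := by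
    rw [setLIntegral_congr_fun (g := fun _ => 0) measurableSet_Iio fun t ht => ?_, lintegral_zero]
    have : {ω | t ≤ |Z ω|} = Set.univ :=
      Set.eq_univ_of_forall fun ω => (le_of_lt (Set.mem_Iio.1 ht)).trans (abs_nonneg (Z ω))
    simp [this, hCC.upperCapacity_univ]
  have upper_part : ∫⁻ t in Set.Ioi (0 : ℝ), S.upperCapacity {ω | t ≤ |Z ω|} ≠ ⊤ := by
    intro htop
    simp [choquet, lower_part, htop] at h
  refine tendsto_of_tendsto_of_tendsto_of_le_of_le tendsto_const_nhds
    (tendsto_setLIntegral_Ioi upper_part) (fun _ => zero_le) fun c => iSup₂_le fun P hP => ?_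
  beta_reduce
  rw [lintegral_excess_eq (measurable_sigmaH hZ).aemeasurable]
  exact lintegral_mono fun t => hCC.measure_le_upperCapacity hP _

end CC
end SublinearExpectationSpace

/-! ### Laws dominated by a sub-linear expectation -/

section LowerSemicontinuous

variable {g : (ℕ → ℝ) → ℝ≥0∞}

/-- A Lipschitz minorant of `g` (its truncated Pasch–Hausdorff envelope) among the functions of
the first `j` coordinates; as `j` grows these minorants increase to `g` if `g` is lower
semicontinuous. -/
noncomputable def cylinderEnvelope (g : (ℕ → ℝ) → ℝ≥0∞) (j : ℕ) (p : Fin j → ℝ) : ℝ :=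
  ⨅ y, ((min (g y) j).toReal + j * dist p (initialSegment j y))

lemma cylinderEnvelope_nonneg (j : ℕ) (p : Fin j → ℝ) : 0 ≤ cylinderEnvelope g j p :=
  Real.iInf_nonneg fun _ => by positivity

lemma cylinderEnvelope_le_add (j : ℕ) (p : Fin j → ℝ) (y : ℕ → ℝ) :
    cylinderEnvelope g j p ≤ (min (g y) j).toReal + j * dist p (initialSegment j y) :=
  ciInf_le ⟨0, by rintro _ ⟨y, rfl⟩; positivity⟩ y

lemma cylinderEnvelope_initialSegment_le (j : ℕ) (z : ℕ → ℝ) :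
    cylinderEnvelope g j (initialSegment j z) ≤ (min (g z) j).toReal := by
  simpa only [dist_self, mul_zero, add_zero] using
    cylinderEnvelope_le_add (g := g) j (initialSegment j z) z

lemma toReal_min_natCast_le (a : ℝ≥0∞) (j : ℕ) : (min a j).toReal ≤ j :=
  ENNReal.toReal_le_of_le_ofReal j.cast_nonneg (by simp)

lemma isBddLip_cylinderEnvelope (g : (ℕ → ℝ) → ℝ≥0∞) (j : ℕ) :
    IsBddLip (cylinderEnvelope g j) := by
  refine ⟨⟨j, fun p => ?_⟩, j, .of_le_add_mul _ fun p q => ?_⟩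
  · have extend : initialSegment j (Function.extend Fin.val p 0) = p :=
      funext fun i => Fin.val_injective.extend_apply p 0 i
    rw [abs_of_nonneg (cylinderEnvelope_nonneg j p), ← extend]
    exact (cylinderEnvelope_initialSegment_le j _).trans (toReal_min_natCast_le _ j)
  · rw [← sub_le_iff_le_add]
    refine le_ciInf fun y => ?_
    have triangle := mul_le_mul_of_nonneg_left (dist_triangle p q (initialSegment j y))
      (Nat.cast_nonneg (α := ℝ) j)
    have := cylinderEnvelope_le_add (g := g) j p y
    simp only [NNReal.coe_natCast]
    linarith

lemma cylinderEnvelope_mono (z : ℕ → ℝ) :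
    Monotone fun j => cylinderEnvelope g j (initialSegment j z) := by
  intro i j hij
  refine le_ciInf fun y => (cylinderEnvelope_le_add i (initialSegment i z) y).trans ?_
  have hdist : dist (initialSegment i z) (initialSegment i y) ≤
      dist (initialSegment j z) (initialSegment j y) :=
    (dist_pi_le_iff dist_nonneg).2 fun k =>
      dist_le_pi_dist (initialSegment j z) (initialSegment j y) (Fin.castLE hij k)
  gcongr
  simp

lemma exists_forall_dist_initialSegment_lt {z : ℕ → ℝ} {s : Set (ℕ → ℝ)} (hs : s ∈ 𝓝 z) :
    ∃ N : ℕ, ∃ δ > 0, ∀ j ≥ N, ∀ y,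
      dist (initialSegment j z) (initialSegment j y) < δ → y ∈ s := by
  rw [nhds_pi] at hs
  obtain ⟨⟨I, r⟩, ⟨hI, hr⟩, hsub⟩ :=
    (hasBasis_pi fun i => Metric.nhds_basis_ball (x := z i)).mem_iff.1 hs
  have eventually_lt_radius : ∀ᶠ δ in 𝓝[>] (0 : ℝ), ∀ i ∈ I, δ < r i :=
    (eventually_all_finite hI).2 fun i hi => nhdsWithin_le_nhds (Iio_mem_nhds (hr i hi))
  obtain ⟨δ, hδr, hδ⟩ := (eventually_lt_radius.and eventually_mem_nhdsWithin).exists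
  obtain ⟨N, hN⟩ := hI.bddAbove
  refine ⟨N + 1, δ, hδ, fun j hj y hy => hsub fun i hi => ?_⟩
  rw [Metric.mem_ball, dist_comm]
  calc dist (z i) (y i) ≤ dist (initialSegment j z) (initialSegment j y) :=
        dist_le_pi_dist (initialSegment j z) (initialSegment j y) ⟨i, (hN hi).trans_lt hj⟩
    _ < r i := hy.trans (hδr i hi)

theorem iSup_cylinderEnvelope (hg : LowerSemicontinuous g) (z : ℕ → ℝ) :
    ⨆ j, ENNReal.ofReal (cylinderEnvelope g j (initialSegment j z)) = g z := by
  refine le_antisymm (iSup_le fun j => ?_) (ENNReal.le_of_forall_nnreal_lt fun a ha => ?_)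
  · exact ENNReal.ofReal_le_of_le_toReal (cylinderEnvelope_initialSegment_le j z) |>.trans
      (min_le_left _ _)
  obtain ⟨N, δ, hδ, hN⟩ := exists_forall_dist_initialSegment_lt (hg z a ha)
  obtain ⟨m, hm⟩ := exists_nat_ge (max (a : ℝ) (a / δ))
  refine le_iSup_of_le (max N m) ?_
  set j := max N m
  have hmj : max (a : ℝ) (a / δ) ≤ j := hm.trans (Nat.cast_le.2 (le_max_right N m))
  rw [← ENNReal.ofReal_coe_nnreal]
  refine ENNReal.ofReal_le_ofReal (le_ciInf fun y => ?_)
  rcases lt_or_ge (dist (initialSegment j z) (initialSegment j y)) δ with hy | hy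
  · have : (a : ℝ≥0∞) ≤ min (g y) j :=
      le_min (hN j (le_max_left N m) y hy).le (by exact_mod_cast (le_max_left _ _).trans hmj)
    have := ENNReal.toReal_mono (by simp) this
    simp only [ENNReal.coe_toReal] at this
    exact this.trans (le_add_of_nonneg_right (by positivity))
  · calc (a : ℝ) = a / δ * δ := by field_simp
      _ ≤ j * dist (initialSegment j z) (initialSegment j y) := by
        gcongr
        exact (le_max_right _ _).trans hmj
      _ ≤ _ := le_add_of_nonneg_left ENNReal.toReal_nonneg

lemma integral_cylinderEnvelope_le {Q : Measure (ℕ → ℝ)} (hg : LowerSemicontinuous g) (j : ℕ)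
    (hfin : ∫⁻ z, g z ∂Q ≠ ⊤) :
    ∫ z, cylinderEnvelope g j (initialSegment j z) ∂Q ≤ (∫⁻ z, g z ∂Q).toReal := by
  have e_measurable := (isBddLip_cylinderEnvelope g j).measurable.comp (measurable_initialSegment j)
  rw [integral_eq_lintegral_of_nonneg_ae (ae_of_all _ fun z => cylinderEnvelope_nonneg j _)
    e_measurable.aestronglyMeasurable]
  refine ENNReal.toReal_mono hfin (lintegral_mono fun z => ?_)
  exact (le_iSup (fun j => ENNReal.ofReal (cylinderEnvelope g j (initialSegment j z))) j).trans_eq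
    (iSup_cylinderEnvelope hg z)

end LowerSemicontinuous

namespace SublinearExpectationSpace

variable {Ω : Type*} [MeasurableSpace Ω] {S : SublinearExpectationSpace Ω}
  {Pfam : Set (@Measure Ω S.sigmaH)} {X : ℕ → Ω → ℝ} {Q : Measure (ℕ → ℝ)}

/-- Under the law `Q` of a sequence, the expectations of bounded Lipschitz functions of finitely
many terms are at most the corresponding sub-linear expectations for the sequence `X`. -/
def IsDominatedLaw (S : SublinearExpectationSpace Ω) (X : ℕ → Ω → ℝ) (Q : Measure (ℕ → ℝ)) :
    Prop :=
  ∀ (n : ℕ) (g : (Fin n → ℝ) → ℝ), IsBddLip g →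
    ∫ z, g (initialSegment n z) ∂Q ≤ (S.E fun ω => g fun i => X i ω).toReal

namespace CC

lemma exists_forall_integral_le_of_monotone (hCC : S.CC Pfam) {W : ℕ → Ω → ℝ}
    (hW : ∀ j, W j ∈ S.Hb) (hmono : ∀ ω, Monotone fun j => W j ω) {c : ℝ}
    (h : ∀ j, ∀ ε > 0, ∃ P ∈ Pfam, ∫ ω, W j ω ∂P ≤ c + ε) :
    ∃ P ∈ Pfam, ∀ j, ∫ ω, W j ω ∂P ≤ c := by
  choose R hR hRc using fun j : ℕ => h j (1 / (j + 1)) Nat.one_div_pos_of_nat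
  obtain ⟨P, hP, hlim⟩ := hCC.exists_tendsto_integral hW (hyperfilter ℕ) R hR
  have hbound : Tendsto (fun n : ℕ => c + 1 / ((n : ℝ) + 1)) (hyperfilter ℕ) (𝓝 c) := by
    simpa only [add_zero] using
      (tendsto_one_div_add_atTop_nhds_zero_nat.const_add c).mono_left Nat.hyperfilter_le_atTop
  refine ⟨P, hP, fun j => le_of_tendsto_of_tendsto (hlim j) hbound ?_⟩
  filter_upwards [Nat.hyperfilter_le_atTop (eventually_ge_atTop j)] with n hn
  have := hCC.isProbability (R n) (hR n)
  exact (integral_mono (integrable_of_mem_Hb (hW j)) (integrable_of_mem_Hb (hW n))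
    fun ω => hmono ω hn).trans (hRc n)

lemma exists_forall_integral_cylinderEnvelope_le (hCC : S.CC Pfam) (hX : ∀ i, X i ∈ S.H)
    (hQ : S.IsDominatedLaw X Q) (g : (ℕ → ℝ) → ℝ≥0∞) {c : ℝ}
    (hc : ∀ j, ∫ z, cylinderEnvelope g j (initialSegment j z) ∂Q ≤ c) :
    ∃ P ∈ Pfam, ∀ j, ∫ ω, cylinderEnvelope g j (fun i => X i ω) ∂P ≤ c := by
  refine hCC.exists_forall_integral_le_of_monotone
    (fun j => comp_mem_Hb (isBddLip_cylinderEnvelope g j) fun i => hX i)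
    (fun ω => cylinderEnvelope_mono fun i => X i ω) fun j ε hε => ?_
  have hneg := (isBddLip_cylinderEnvelope g j).neg
  have dominated := hQ j _ hneg
  obtain ⟨P, hP, h⟩ := hCC.exists_lt_integral (comp_mem_Hb hneg fun i => hX i)
    ((sub_lt_self _ hε).trans_le dominated)
  rw [integral_neg, integral_neg] at h
  exact ⟨P, hP, by linarith [hc j]⟩

theorem exists_lintegral_le_of_lowerSemicontinuous (hCC : S.CC Pfam) (hX : ∀ i, X i ∈ S.H)
    (hQ : S.IsDominatedLaw X Q) {g : (ℕ → ℝ) → ℝ≥0∞}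
    (hg : LowerSemicontinuous g) :
    ∃ P ∈ Pfam, ∫⁻ ω, g (fun i => X i ω) ∂P ≤ ∫⁻ z, g z ∂Q := by
  rcases eq_or_ne (∫⁻ z, g z ∂Q) ⊤ with htop | hfin
  · obtain ⟨P, hP⟩ := hCC.nonempty
    exact ⟨P, hP, htop ▸ le_top⟩
  obtain ⟨P, hP, h⟩ := hCC.exists_forall_integral_cylinderEnvelope_le hX hQ g
    fun j => integral_cylinderEnvelope_le hg j hfin
  have := hCC.isProbability P hP
  refine ⟨P, hP, ?_⟩
  have e_mem (j : ℕ) : (fun ω => cylinderEnvelope g j fun i => X i ω) ∈ S.Hb :=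
    comp_mem_Hb (isBddLip_cylinderEnvelope g j) fun i => hX i
  calc ∫⁻ ω, g (fun i => X i ω) ∂P
      = ∫⁻ ω, ⨆ j, ENNReal.ofReal (cylinderEnvelope g j fun i => X i ω) ∂P :=
        lintegral_congr fun ω => (iSup_cylinderEnvelope hg fun i => X i ω).symm
    _ = ⨆ j, ∫⁻ ω, ENNReal.ofReal (cylinderEnvelope g j fun i => X i ω) ∂P :=
        lintegral_iSup (fun j => (measurable_sigmaH (e_mem j).1).ennreal_ofReal)
          fun i j hij ω => ENNReal.ofReal_le_ofReal (cylinderEnvelope_mono (fun i => X i ω) hij)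
    _ ≤ ∫⁻ z, g z ∂Q := iSup_le fun j => by
        rw [← ofReal_integral_eq_lintegral_ofReal (integrable_of_mem_Hb (e_mem j))
          (ae_of_all _ fun ω => cylinderEnvelope_nonneg j _)]
        exact ENNReal.ofReal_le_of_le_toReal (h j)

theorem exists_measure_eq_one (hCC : S.CC Pfam) (hX : ∀ i, X i ∈ S.H) [IsProbabilityMeasure Q]
    (hQ : S.IsDominatedLaw X Q) {A : Set (ℕ → ℝ)} (hA : MeasurableSet A) (hQA : Q A = 1) :
    ∃ P ∈ Pfam, P {ω | (fun i => X i ω) ∈ A} = 1 := by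
  obtain ⟨g, hle, hg, hgQ⟩ := exists_le_lowerSemicontinuous_lintegral_ge (μ := Q)
    (Aᶜ.indicator fun _ => ⊤) (measurable_const.indicator hA.compl) one_ne_zero
  have integral_g_le : ∫⁻ z, g z ∂Q ≤ 1 := by
    simpa [lintegral_indicator hA.compl, (prob_compl_eq_zero_iff hA).2 hQA] using hgQ
  obtain ⟨P, hP, h⟩ := hCC.exists_lintegral_le_of_lowerSemicontinuous hX hQ hg
  have := hCC.isProbability P hP
  have hXm := measurable_sigmaH_pi hX
  refine ⟨P, hP, (mem_ae_iff_prob_eq_one (hXm hA)).1 ?_⟩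
  filter_upwards [ae_lt_top (hg.measurable.comp hXm)
    ((h.trans integral_g_le).trans_lt ENNReal.one_lt_top).ne] with ω hω
  by_contra hωA
  have := (hle fun i => X i ω).trans_lt hω
  rw [Set.indicator_of_mem hωA] at this
  exact lt_irrefl _ this

end CC

end SublinearExpectationSpace

/-! ### Chains of mixtures -/

section Mixture

variable {α E : Type*} [MeasurableSpace α] [MeasurableSpace E] {θ₁ θ₂ : Measure E}

/-- The mixture of two measures with weights `w` and `1 - w`. -/
noncomputable def mixture (θ₁ θ₂ : Measure E) (w : unitInterval) : Measure E :=
  unitInterval.toNNReal w • θ₁ + unitInterval.toNNReal (unitInterval.symm w) • θ₂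

instance isProbabilityMeasure_mixture [IsProbabilityMeasure θ₁] [IsProbabilityMeasure θ₂]
    (w : unitInterval) : IsProbabilityMeasure (mixture θ₁ θ₂ w) := ⟨by
  simp only [mixture, Measure.add_apply, Measure.smul_apply, measure_univ, ENNReal.smul_def,
    smul_eq_mul, mul_one]
  exact_mod_cast unitInterval.toNNReal_add_toNNReal_symm w⟩

lemma mixture_le_add (w : unitInterval) : mixture θ₁ θ₂ w ≤ θ₁ + θ₂ := by
  have smul_le (v : unitInterval) (θ : Measure E) : unitInterval.toNNReal v • θ ≤ θ :=
    Measure.le_iff.2 fun s _ => mul_le_of_le_one_left zero_le (by exact_mod_cast v.2.2)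
  exact add_le_add (smul_le w θ₁) (smul_le (unitInterval.symm w) θ₂)

lemma measurable_mixture : Measurable (mixture θ₁ θ₂) := by
  refine Measure.measurable_of_measurable_coe _ fun s _ => ?_
  simp only [mixture, Measure.add_apply, Measure.smul_apply, ENNReal.smul_def, smul_eq_mul]
  fun_prop

/-- The mixture of two measures with a weight that depends on a parameter. -/
noncomputable def mixtureKernel (θ₁ θ₂ : Measure E) {w : α → unitInterval} (hw : Measurable w) :
    Kernel α E :=
  ⟨fun p => mixture θ₁ θ₂ (w p), measurable_mixture.comp hw⟩

instance isMarkovKernel_mixtureKernel [IsProbabilityMeasure θ₁] [IsProbabilityMeasure θ₂]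
    {w : α → unitInterval} (hw : Measurable w) : IsMarkovKernel (mixtureKernel θ₁ θ₂ hw) :=
  ⟨fun p => isProbabilityMeasure_mixture (w p)⟩

lemma integral_mixture {f : E → ℝ} (h₁ : Integrable f θ₁) (h₂ : Integrable f θ₂)
    (w : unitInterval) :
    ∫ x, f x ∂mixture θ₁ θ₂ w = w * ∫ x, f x ∂θ₁ + (1 - w) * ∫ x, f x ∂θ₂ := by
  rw [mixture, integral_add_measure h₁.smul_measure_nnreal h₂.smul_measure_nnreal,
    integral_smul_nnreal_measure, integral_smul_nnreal_measure]
  rfl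

lemma integral_mixture_le {f : E → ℝ} (h₁ : Integrable f θ₁) (h₂ : Integrable f θ₂) {c : ℝ}
    (hc₁ : ∫ x, f x ∂θ₁ ≤ c) (hc₂ : ∫ x, f x ∂θ₂ ≤ c) (w : unitInterval) :
    ∫ x, f x ∂mixture θ₁ θ₂ w ≤ c := by
  rw [integral_mixture h₁ h₂]
  calc w * ∫ x, f x ∂θ₁ + (1 - w) * ∫ x, f x ∂θ₂ ≤ w * c + (1 - w) * c :=
        add_le_add (mul_le_mul_of_nonneg_left hc₁ w.2.1)
          (mul_le_mul_of_nonneg_left hc₂ (sub_nonneg.2 w.2.2))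
    _ = c := by ring

/-- The weight `w` for which `w * a + (1 - w) * b = 0`, where `b ≤ 0 ≤ a`. -/
noncomputable def balancingWeight (a b : ℝ) : unitInterval :=
  Set.projIcc 0 1 zero_le_one (-b / (a - b))

lemma balancingWeight_spec {a b : ℝ} (ha : 0 ≤ a) (hb : b ≤ 0) :
    balancingWeight a b * a + (1 - balancingWeight a b) * b = 0 := by
  have hab : 0 ≤ a - b := by linarith
  have mem : -b / (a - b) ∈ Set.Icc (0 : ℝ) 1 :=
    ⟨div_nonneg (neg_nonneg.2 hb) hab, div_le_one_of_le₀ (by linarith) hab⟩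
  rw [balancingWeight, Set.projIcc_of_mem zero_le_one mem]
  rcases hab.eq_or_lt with h | h
  · obtain ⟨rfl, rfl⟩ : a = 0 ∧ b = 0 := ⟨by linarith, by linarith⟩
    simp
  · field_simp
    ring

lemma exists_integral_mixture_eq_zero [SFinite θ₁] [SFinite θ₂] {D : α × E → ℝ}
    (hD : Measurable D) (hD₁ : ∀ p, Integrable (fun x => D (p, x)) θ₁)
    (hD₂ : ∀ p, Integrable (fun x => D (p, x)) θ₂) (h₁ : ∀ p, 0 ≤ ∫ x, D (p, x) ∂θ₁)
    (h₂ : ∀ p, ∫ x, D (p, x) ∂θ₂ ≤ 0) :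
    ∃ w : α → unitInterval, Measurable w ∧ ∀ p, ∫ x, D (p, x) ∂mixture θ₁ θ₂ (w p) = 0 := by
  refine ⟨fun p => balancingWeight (∫ x, D (p, x) ∂θ₁) (∫ x, D (p, x) ∂θ₂),
    continuous_projIcc.measurable.comp ?_, fun p => ?_⟩
  · have hm₁ := hD.stronglyMeasurable.integral_prod_right' (ν := θ₁) |>.measurable
    have hm₂ := hD.stronglyMeasurable.integral_prod_right' (ν := θ₂) |>.measurable
    fun_prop
  · rw [integral_mixture (hD₁ p) (hD₂ p)]
    exact balancingWeight_spec (h₁ p) (h₂ p)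

end Mixture

section MixtureChain

variable {φ : (i : ℕ) → (Fin (i + 1) → ℝ) → ℝ} {θ₁ θ₂ : Measure ℝ} [IsProbabilityMeasure θ₁]
  [IsProbabilityMeasure θ₂]

lemma snoc_initialSegment {E : Type*} (n : ℕ) (z : ℕ → E) :
    Fin.snoc (α := fun _ => E) (initialSegment n z) (z n) = initialSegment (n + 1) z :=
  Fin.snoc_init_self (α := fun _ => E) (initialSegment (n + 1) z)

lemma lipschitzWith_snoc (n : ℕ) : LipschitzWith 1 fun q : (Fin n → ℝ) × ℝ =>
    (Fin.snoc (α := fun _ => ℝ) q.1 q.2 : Fin (n + 1) → ℝ) := by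
  refine LipschitzWith.of_dist_le_mul fun q r => ?_
  rw [NNReal.coe_one, one_mul, dist_pi_le_iff dist_nonneg]
  refine Fin.lastCases ?_ fun j => ?_
  · rw [Fin.snoc_last, Fin.snoc_last]
    exact le_max_right _ _
  · rw [Fin.snoc_castSucc, Fin.snoc_castSucc]
    exact (dist_le_pi_dist q.1 r.1 j).trans (le_max_left _ _)

lemma exists_weights_integral_sub_snoc_eq_zero (hi₁ : Integrable (fun x => x) θ₁)
    (hi₂ : Integrable (fun x => x) θ₂) {n : ℕ} {f : (Fin (n + 1) → ℝ) → ℝ} (hf : Measurable f)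
    (hfI : ∀ x, f x ∈ Set.Icc (∫ x, x ∂θ₂) (∫ x, x ∂θ₁)) :
    ∃ w : (Fin n → ℝ) → unitInterval, Measurable w ∧
      ∀ p, ∫ x, (x - f (Fin.snoc (α := fun _ => ℝ) p x)) ∂mixture θ₁ θ₂ (w p) = 0 := by
  have hsnoc : Measurable fun q : (Fin n → ℝ) × ℝ => f (Fin.snoc (α := fun _ => ℝ) q.1 q.2) := by
    fun_prop
  have hint (θ : Measure ℝ) [IsProbabilityMeasure θ] (p : Fin n → ℝ) :
      Integrable (fun x => f (Fin.snoc (α := fun _ => ℝ) p x)) θ :=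
    .of_bound (hsnoc.comp measurable_prodMk_left).aestronglyMeasurable
      (max |∫ x, x ∂θ₂| |∫ x, x ∂θ₁|)
      (ae_of_all _ fun x => abs_le_max_abs_abs (hfI _).1 (hfI _).2)
  refine exists_integral_mixture_eq_zero
    (D := fun q => q.2 - f (Fin.snoc (α := fun _ => ℝ) q.1 q.2)) (measurable_snd.sub hsnoc)
    (fun p => hi₁.sub (hint θ₁ p)) (fun p => hi₂.sub (hint θ₂ p)) (fun p => ?_) fun p => ?_
  · dsimp only
    rw [integral_sub hi₁ (hint θ₁ p), sub_nonneg]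
    simpa using integral_mono (hint θ₁ p) (integrable_const _) fun x => (hfI _).2
  · dsimp only
    rw [integral_sub hi₂ (hint θ₂ p), sub_nonpos]
    simpa using integral_mono (integrable_const _) (hint θ₂ p) fun x => (hfI _).1

theorem exists_isChainLaw_mixtureKernel_ae_mem_convSet (hi₁ : Integrable (fun x => x) θ₁)
    (hi₂ : Integrable (fun x => x) θ₂) (hφ : ∀ i, Measurable (φ i))
    (hφI : ∀ i x, φ i x ∈ Set.Icc (∫ x, x ∂θ₂) (∫ x, x ∂θ₁)) :
    ∃ (w : (n : ℕ) → (Fin n → ℝ) → unitInterval) (hw : ∀ n, Measurable (w n))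
      (Q : Measure (ℕ → ℝ)), IsProbabilityMeasure Q ∧
      IsChainLaw Q (fun n => mixtureKernel θ₁ θ₂ (hw n)) ∧
      ∀ᵐ z ∂Q, z ∈ SublinearExpectationSpace.convSet (fun i z => z i) φ := by
  choose w hw hw0 using fun n =>
    exists_weights_integral_sub_snoc_eq_zero hi₁ hi₂ (n := n) (hφ n) (hφI n)
  obtain ⟨Q, hQprob, hQ⟩ := exists_isChainLaw fun n => mixtureKernel θ₁ θ₂ (hw n)
  refine ⟨w, hw, Q, hQprob, hQ, ?_⟩
  set C := max |∫ x, x ∂θ₂| |∫ x, x ∂θ₁|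
  have hφC (i) (x) : |φ i x| ≤ C := abs_le_max_abs_abs (hφI i x).1 (hφI i x).2
  have slln := hQ.ae_tendsto_average (θ := θ₁ + θ₂) (G := fun x => |x| + C)
    (D := fun n q => q.2 - φ n (Fin.snoc (α := fun _ => ℝ) q.1 q.2))
    (fun n p => mixture_le_add (w n p)) (by fun_prop)
    ((hi₁.add_measure hi₂).abs.add (integrable_const C)) (fun n => by fun_prop)
    (fun n q => (abs_sub _ _).trans (by gcongr; exact hφC n _)) hw0
  filter_upwards [slln] with z hz
  simp only [snoc_initialSegment, Finset.sum_sub_distrib] at hz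
  exact hz

end MixtureChain

/-! ### Independent sequences -/

namespace SublinearExpectationSpace

variable {Ω : Type*} [MeasurableSpace Ω] {S : SublinearExpectationSpace Ω}
  {X : ℕ → Ω → ℝ} {Z : Ω → ℝ} {n : ℕ}
  {g : (Fin (n + 1) → ℝ) → ℝ}

/-- The sub-linear expectation of `g (p, Z)` as a function of `p`, the inner expectation in the
definition of independence. It is finite for bounded Lipschitz `g`. -/
noncomputable def lastExpectation (S : SublinearExpectationSpace Ω) (Z : Ω → ℝ)
    (g : (Fin (n + 1) → ℝ) → ℝ) (p : Fin n → ℝ) : ℝ :=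
  (S.E fun ω => g (Fin.snoc (α := fun _ => ℝ) p (Z ω))).toReal

lemma isBddLip_snoc (hg : IsBddLip g) (p : Fin n → ℝ) :
    IsBddLip fun x => g (Fin.snoc (α := fun _ => ℝ) p x) :=
  (hg.comp (lipschitzWith_snoc n)).comp (LipschitzWith.prodMk_left p)

lemma isBddLip_lastExpectation (hg : IsBddLip g) (hZ : Z ∈ S.H) :
    IsBddLip (S.lastExpectation Z g) := by
  have mem (p) := real_comp_mem_Hb (isBddLip_snoc hg p) hZ
  obtain ⟨⟨M, hM⟩, K, hK⟩ := hg.comp (lipschitzWith_snoc n)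
  refine ⟨⟨M, fun p => abs_toReal_E_le (mem p).1 fun ω => hM (p, Z ω)⟩, K,
    .of_le_add_mul K fun p q => toReal_E_le_add (mem p) (mem q) fun ω => ?_⟩
  have := hK.dist_le_mul (p, Z ω) (q, Z ω)
  rw [Prod.dist_eq, dist_self, max_eq_left dist_nonneg] at this
  linarith [(le_abs_self _).trans this]

lemma IsIID.E_real_comp_eq (hX : S.IsIID X) (n : ℕ) {f : ℝ → ℝ} (hf : IsBddLip f) :
    S.E (fun ω => f (X n ω)) = S.E fun ω => f (X 0 ω) :=
  hX.identDist n (fun y => f (y 0)) (hf.comp (LipschitzWith.eval (α := fun _ : Fin 1 => ℝ) 0))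

lemma IsIID.E_eq_E_lastExpectation (hX : S.IsIID X) (hg : IsBddLip g) :
    S.E (fun ω => g fun i => X i ω) = S.E fun ω => S.lastExpectation (X n) g fun i => X i ω := by
  have split (ω : Ω) : (g fun i => X i ω) =
      g (Fin.snoc (α := fun _ => ℝ) (fun i : Fin n => X i ω) (X n ω)) :=
    congrArg g (snoc_initialSegment n fun i => X i ω).symm
  simp_rw [split]
  cases n with
  | zero =>
    simp only [Subsingleton.elim _ (Fin.elim0 : Fin 0 → ℝ)]
    rw [S.const]
    exact (coe_toReal_E (real_comp_mem_Hb (isBddLip_snoc hg _) (hX.mem 0))).symm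
  | succ i =>
    have lipschitz : LipschitzWith 1 fun q : (Fin (i + 1) → ℝ) × (Fin 1 → ℝ) => (q.1, q.2 0) :=
      LipschitzWith.of_dist_le_mul fun q r => by
        rw [NNReal.coe_one, one_mul]
        exact max_le_max le_rfl (dist_le_pi_dist q.2 r.2 0)
    exact hX.indep i _ ((hg.comp (lipschitzWith_snoc _)).comp lipschitz)

theorem IsIID.isDominatedLaw (hX : S.IsIID X) {Q : Measure (ℕ → ℝ)} [IsProbabilityMeasure Q]
    {κ : (n : ℕ) → Kernel (Fin n → ℝ) ℝ} [∀ n, IsMarkovKernel (κ n)] (hQ : IsChainLaw Q κ)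
    (hκ : ∀ n p (f : ℝ → ℝ), IsBddLip f →
      ∫ x, f x ∂κ n p ≤ (S.E fun ω => f (X 0 ω)).toReal) :
    S.IsDominatedLaw X Q := by
  intro n
  induction n with
  | zero =>
    intro g _
    simp only [Subsingleton.elim _ (Fin.elim0 : Fin 0 → ℝ), S.const, integral_const,
      probReal_univ, one_smul, EReal.toReal_coe, le_rfl]
  | succ n ih =>
    intro g hg
    have hφ := hg.comp (lipschitzWith_snoc n)
    have hψ := isBddLip_lastExpectation hg (hX.mem n)
    calc ∫ z, g (initialSegment (n + 1) z) ∂Q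
        = ∫ z, g (Fin.snoc (α := fun _ => ℝ) (initialSegment n z) (z n)) ∂Q := by
          simp_rw [snoc_initialSegment]
      _ ≤ ∫ z, S.lastExpectation (X n) g (initialSegment n z) ∂Q := by
          refine hQ.integral_le_integral hφ.measurable hψ.measurable
            (hφ.integrable_comp (measurable_initialSegment_prodMk n))
            (hψ.integrable_comp (measurable_initialSegment n)) fun p => ?_
          rw [lastExpectation, hX.E_real_comp_eq n (isBddLip_snoc hg p)]
          exact hκ n p _ (isBddLip_snoc hg p)
      _ ≤ (S.E fun ω => S.lastExpectation (X n) g fun i => X i ω).toReal := ih _ hψ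
      _ = (S.E fun ω => g fun i => X i ω).toReal := by rw [hX.E_eq_E_lastExpectation hg]

end SublinearExpectationSpace

namespace SublinearExpectationSpace

variable {Ω : Type*} [MeasurableSpace Ω] {S : SublinearExpectationSpace Ω}
  {Pfam : Set (@Measure Ω S.sigmaH)} {X : ℕ → Ω → ℝ} {φ : (i : ℕ) → (Fin (i + 1) → ℝ) → ℝ}

lemma measurableSet_convSet (hX : ∀ i, Measurable (X i))
    (hφ : ∀ i, Measurable (φ i)) : MeasurableSet (convSet X φ) :=
  measurableSet_tendsto _ fun n => by fun_prop

lemma CC.integral_map_le (hCC : S.CC Pfam) {P : @Measure Ω S.sigmaH} (hP : P ∈ Pfam)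
    {Z : Ω → ℝ} (hZ : Z ∈ S.H) {f : ℝ → ℝ} (hf : IsBddLip f) :
    ∫ x, f x ∂(@Measure.map Ω ℝ S.sigmaH _ Z P) ≤ (S.E fun ω => f (Z ω)).toReal := by
  rw [integral_map (measurable_sigmaH hZ).aemeasurable hf.measurable.aestronglyMeasurable]
  exact hCC.integral_le_toReal_E hP (real_comp_mem_Hb hf hZ)

theorem CC.exists_measure_convSet_eq_one (hCC : S.CC Pfam) (hX : S.IsIID X)
    {P₁ P₂ : @Measure Ω S.sigmaH} (hP₁ : P₁ ∈ Pfam) (hP₂ : P₂ ∈ Pfam)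
    (hi₁ : Integrable (X 0) P₁) (hi₂ : Integrable (X 0) P₂)
    (hφ : ∀ i, Measurable (φ i))
    (hφI : ∀ i x, φ i x ∈ Set.Icc (∫ ω, X 0 ω ∂P₂) (∫ ω, X 0 ω ∂P₁)) :
    ∃ P ∈ Pfam, P (convSet X φ) = 1 := by
  have hX0 := (measurable_sigmaH (hX.mem 0)).aemeasurable (μ := P₁)
  have hX0' := (measurable_sigmaH (hX.mem 0)).aemeasurable (μ := P₂)
  have := hCC.isProbability P₁ hP₁
  have := hCC.isProbability P₂ hP₂
  have := Measure.isProbabilityMeasure_map hX0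
  have := Measure.isProbabilityMeasure_map hX0'
  have hid {P : Measure ℝ} : AEStronglyMeasurable (fun x : ℝ => x) P :=
    measurable_id.aestronglyMeasurable
  obtain ⟨w, hw, Q, hQprob, hQ, hQconv⟩ := exists_isChainLaw_mixtureKernel_ae_mem_convSet
    ((integrable_map_measure hid hX0).2 hi₁) ((integrable_map_measure hid hX0').2 hi₂) hφ
    (by rwa [integral_map hX0 hid, integral_map hX0' hid])
  have dominated : S.IsDominatedLaw X Q := hX.isDominatedLaw hQ fun n p _ hf =>
    integral_mixture_le (hf.integrable_comp measurable_id) (hf.integrable_comp measurable_id)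
      (hCC.integral_map_le hP₁ (hX.mem 0) hf) (hCC.integral_map_le hP₂ (hX.mem 0) hf) (w n p)
  have hA := measurableSet_convSet (fun i => measurable_pi_apply (X := fun _ => ℝ) i) hφ
  exact hCC.exists_measure_eq_one hX.mem dominated hA ((mem_ae_iff_prob_eq_one hA).1 hQconv)

end SublinearExpectationSpace

theorem theorem2p2_general {Ω : Type*} [MeasurableSpace Ω] (S : SublinearExpectationSpace Ω)
    (Pfam : Set (@Measure Ω S.sigmaH)) (hCC : S.CC Pfam) (X : ℕ → Ω → ℝ) (hX : S.IsIID X)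
    (hui : UniformlyIntegrable Pfam (X 0)) :
    ∃ μlo μhi : ℝ, S.HasLowerMean (X 0) μlo ∧ S.HasUpperMean (X 0) μhi ∧
      ∀ φ : (i : ℕ) → (Fin (i + 1) → ℝ) → ℝ,
        (∀ i, Measurable (φ i)) → (∀ i x, φ i x ∈ Set.Icc μlo μhi) →
        ∃ P ∈ Pfam, S.outerCapacity (SublinearExpectationSpace.convSet X φ) = 1 ∧
          P (SublinearExpectationSpace.convSet X φ) = 1 := by
  have integrable {P} (hP : P ∈ Pfam) : Integrable (X 0) P :=
    have := hCC.isProbability P hP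
    hui.integrable (SublinearExpectationSpace.measurable_sigmaH (hX.mem 0)) hP
  obtain ⟨P₁, hP₁, upper⟩ := hCC.exists_hasUpperMean (hX.mem 0) hui
  obtain ⟨P₂, hP₂, lower⟩ := hCC.exists_hasLowerMean (hX.mem 0) hui
  refine ⟨_, _, lower, upper, fun φ hφ hφI => ?_⟩
  obtain ⟨P, hP, h⟩ := hCC.exists_measure_convSet_eq_one hX hP₁ hP₂ (integrable hP₁)
    (integrable hP₂) hφ hφI
  exact ⟨P, hP, hCC.outerCapacity_eq_one hP h, h⟩

theorem theorem2p2 {Ω : Type*} [MeasurableSpace Ω] (S : SublinearExpectationSpace Ω)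
    (Pfam : Set (@MeasureTheory.Measure Ω S.sigmaH)) (hCC : S.CC Pfam)
    (X : ℕ → Ω → ℝ) (hX : S.IsIID X) (hC : S.choquet (fun ω => |X 0 ω|) < ⊤) :
    ∃ μlo μhi : ℝ, S.HasLowerMean (X 0) μlo ∧ S.HasUpperMean (X 0) μhi ∧
      (∀ φ : (i : ℕ) → (Fin (i + 1) → ℝ) → ℝ,
        (∀ i, Measurable (φ i)) → (∀ i x, φ i x ∈ Set.Icc μlo μhi) →
        ∃ Q : @MeasureTheory.Measure Ω S.sigmaH, MeasureTheory.IsProbabilityMeasure Q ∧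
          (∀ Y ∈ S.Hb, ((∫ ω, Y ω ∂Q : ℝ) : EReal) ≤ S.E Y) ∧
          S.outerCapacity (SublinearExpectationSpace.convSet X φ) = 1 ∧
          Q (SublinearExpectationSpace.convSet X φ) = 1) ∧
      (∀ φ : (i : ℕ) → (Fin (i + 1) → ℝ) → ℝ,
        (∀ i, Continuous (φ i)) → (∀ i x, φ i x ∈ Set.Icc μlo μhi) →
        ∃ P ∈ Pfam,
          S.outerCapacity (SublinearExpectationSpace.convSet X φ) = 1 ∧
          P (SublinearExpectationSpace.convSet X φ) = 1) := by
  obtain ⟨μlo, μhi, lower, upper, h⟩ := theorem2p2_general S Pfam hCC X hX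
    (hCC.uniformlyIntegrable_of_choquet_lt_top (hX.mem 0) hC)
  refine ⟨μlo, μhi, lower, upper, fun φ hφ hφI => ?_, fun φ hφ => h φ fun i => (hφ i).measurable⟩
  obtain ⟨P, hP, hconv⟩ := h φ hφ hφI
  exact ⟨P, hCC.isProbability P hP, fun Y hY => hCC.integral_le_E hP hY, hconv⟩
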